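/- **Theorem 2.1.** A piecewise $C^2$ curve is given by a continuous map $\gamma=(\gamma_1,\gamma_2):[0,T]\to\mathbb{R}^2$ and a partition $0=a_0<a_1<\dots<a_n=T$ such that $\gamma$ is of class $C^2$ on each open interval $(a_{i-1},a_i)$, $1\le i\le n$. Its curvature at a parameter $t$ in one of these open intervals is $$\kappa(t)=\frac{|\gamma_1'(t)\gamma_2''(t)-\gamma_2'(t)\gamma_1''(t)|}{|\gamma'(t)|^3},$$ with the convention $\kappa(t)=0$ if $\gamma'(t)=0$. The curve is called piecewise linear if $\kappa(t)=0$ for every $t\in(a_{i-1},a_i)$ and every $i=1,\dots,n$. Let $\Gamma=\gamma([0,T])$ be a piecewise $C^2$ curve which is not piecewise linear, let $A\subset\mathbb{R}^2$ be an arbitrary set, and let $A+\Gamma=\{a+g: a\in A,\ g\in\Gamma\}$. Write $\dim_H$ for Hausdorff dimension and $\mathcal{L}^2$ for Lebesgue (outer) measure on $\mathbb{R}^2$. (a) If $\dim_H A>1$, then $\mathcal{L}^2(A+\Gamma)>0$. (b) If $A\neq\emptyset$ and $\dim_H A\le 1$, then $\dim_H(A+\Gamma)=1+\dim_H A$. 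-/

import Mathlib

open Set MeasureTheory
open scoped Pointwise

/-- The Euclidean plane. -/
abbrev Plane : Type := EuclideanSpace ℝ (Fin 2)

/-- A piecewise `C²` curve in the plane: a continuous map `γ : [0, T] → ℝ²` together with a
partition `0 = a₀ < a₁ < ⋯ < aₙ = T` such that `γ` is twice continuously differentiable on every
open interval `(aᵢ₋₁, aᵢ)`. The values of `toFun` outside `[0, T]` are irrelevant. -/
structure PiecewiseC2Curve where
  /-- the right endpoint of the parameter interval -/
  T : ℝ
  /-- the parametrization -/
  toFun : ℝ → Plane
  /-- the number of pieces -/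
  n : ℕ
  /-- the points of the partition -/
  a : Fin (n + 1) → ℝ
  strictMono_a : StrictMono a
  a_zero : a 0 = 0
  a_last : a (Fin.last n) = T
  continuousOn : ContinuousOn toFun (Icc 0 T)
  contDiffOn : ∀ i : Fin n, ContDiffOn ℝ 2 toFun (Ioo (a i.castSucc) (a i.succ))

/-- The curvature `|x' y'' - y' x''| / |γ'|³` of a parametrized plane curve `γ = (x, y)`
at the parameter `t`. It is `0` by convention where the velocity `γ'(t)` vanishes. -/
noncomputable def planeCurvature (γ : ℝ → Plane) (t : ℝ) : ℝ :=
  |deriv γ t 0 * deriv (deriv γ) t 1 - deriv γ t 1 * deriv (deriv γ) t 0| / ‖deriv γ t‖ ^ 3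

namespace PiecewiseC2Curve

/-- The curve as a subset of the plane. -/
def carrier (Γ : PiecewiseC2Curve) : Set Plane :=
  Γ.toFun '' Icc 0 Γ.T

/-- The curve is piecewise linear if its curvature is zero at every point of every
open interval of the partition. -/
def IsPiecewiseLinear (Γ : PiecewiseC2Curve) : Prop :=
  ∀ i : Fin Γ.n, ∀ t ∈ Ioo (Γ.a i.castSucc) (Γ.a i.succ), planeCurvature Γ.toFun t = 0

end PiecewiseC2Curve

/-!
The lower bounds rest on transversality. A curve that is not piecewise linear contains an arc which
is, over one of the coordinates, the graph `G` of a uniformly convex or concave function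
(`PiecewiseC2Curve.exists_isCurvedGraph`). Two translates of such an arc by `x` and `y` are `r`-close
to each other only on a set of pairs of parameters of measure `O(r ^ 2 / |x - y|)`
(`IsCurvedGraph.volume_closePairs_le_div`): this coordinate confines the difference `h` of the
parameters to an interval of length `2 * r`, and the second differences of the graph confine the
parameter itself, for given `h`, to a set of diameter `O(r / |h|)`.

Suppose that, for every `x` in `A`, the translate `x + G` spends a time at least `e` in a union of
`N` sets of diameter `δ`. By a discrete Frostman lemma (`exists_frostman_weights`), finitely many
points of `A` carry weights whose total mass is at least a constant multiple of the `s`-dimensional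
Hausdorff content of `A`, with mass `O(r ^ s)` in balls of radius `r ≥ δ`. The Cauchy–Schwarz inequality and the
transversality bound then show that the content is `O(N * δ ^ τ / e ^ 2)`, where `τ = 1 + s` if
`s < 1` and `τ = 2` if `1 < s` (`IsCurvedGraph.hausdorffContent_le_single_scale`). Everything takes
place on finite sets of points, so `A` need not be measurable.

A cover of `A + Γ` is split into countably many families to which this estimate applies; if their
sizes decrease geometrically, thresholds `e` with a small sum can be chosen and the estimates add up
(`IsCurvedGraph.hausdorffContent_le_multi_scale`). If `A + Γ` is null in dimension `u < 1 + s`, where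
`s < 1`, one groups the covering sets by size, and the gap between `u` and `1 + s` gives the
geometric decay. If `A + Γ` is null in dimension `2` and `1 < s`, one groups them along a sparse
sequence of indices and subdivides the sets of each group to a common size. In both cases `A` has
content zero in dimension `s`. This leaves the case `dimH A = 0` of the lower bound, where a single
translate of the arc suffices, since it projects onto an interval.

The upper bound `dimH (A + Γ) ≤ 1 + dimH A` holds because `Γ` is a countable union of points and
Lipschitz arcs.
-/

/-! ### Hausdorff content -/

/-- The `s`-dimensional Hausdorff content `inf ∑ (diam Uₙ) ^ s`, the infimum being over all
countable covers. In contrast to Hausdorff measure, there is no bound on the diameters. By the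
definition of `boundedBy`, empty sets of a cover contribute `0` for every `s`. -/
noncomputable def hausdorffContent {X : Type*} [EMetricSpace X] (s : ℝ) : OuterMeasure X :=
  OuterMeasure.boundedBy fun t => Metric.ediam t ^ s

theorem hausdorffContent_le_ediam {X : Type*} [EMetricSpace X] (s : ℝ) (t : Set X) :
    hausdorffContent s t ≤ Metric.ediam t ^ s :=
  OuterMeasure.boundedBy_le _

theorem hausdorffContent_apply {X : Type*} [EMetricSpace X] (s : ℝ) (A : Set X) :
    hausdorffContent s A = ⨅ (t : ℕ → Set X) (_ : A ⊆ ⋃ n, t n),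
      ∑' n, ⨆ _ : (t n).Nonempty, Metric.ediam (t n) ^ s :=
  OuterMeasure.boundedBy_apply _

theorem exists_cover_of_hausdorffContent_lt {X : Type*} [EMetricSpace X] {s : ℝ} (hs : 0 < s)
    {A : Set X} {c : ENNReal} (h : hausdorffContent s A < c) :
    ∃ t : ℕ → Set X, A ⊆ ⋃ n, t n ∧ ∑' n, Metric.ediam (t n) ^ s < c := by
  rw [hausdorffContent_apply] at h
  simp only [iInf_lt_iff] at h
  obtain ⟨t, ht, h⟩ := h
  refine ⟨t, ht, lt_of_le_of_lt (ENNReal.tsum_le_tsum fun n => ?_) h⟩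
  rcases (t n).eq_empty_or_nonempty with h0 | h0
  · simp [h0, hs]
  · simp [h0]

theorem hausdorffContent_le_hausdorffMeasure {X : Type*} [EMetricSpace X] [MeasurableSpace X]
    [BorelSpace X] (s : ℝ) (A : Set X) : hausdorffContent s A ≤ μH[s] A := by
  rw [hausdorffContent_apply, Measure.hausdorffMeasure_apply]
  refine le_trans ?_ (le_iSup₂ (⊤ : ENNReal) (by simp))
  simp

theorem hausdorffMeasure_eq_zero_of_hausdorffContent {X : Type*} [EMetricSpace X]
    [MeasurableSpace X] [BorelSpace X] {s : ℝ} (hs : 0 < s) {A : Set X}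
    (h : hausdorffContent s A = 0) : μH[s] A = 0 := by
  rw [Measure.hausdorffMeasure_apply, ← nonpos_iff_eq_zero]
  refine iSup₂_le fun r hr => ?_
  refine le_of_forall_gt fun ε hε => ?_
  -- a cover whose sum is below `r ^ s` consists of sets of diameter at most `r`
  have hr' : 0 < min ε (r ^ s) := by
    rcases eq_or_ne r ⊤ with rfl | hr1
    · simp [ENNReal.top_rpow_of_pos hs, hε]
    · exact lt_min hε (ENNReal.rpow_pos hr hr1)
  obtain ⟨t, ht, hsum⟩ := exists_cover_of_hausdorffContent_lt hs (h ▸ hr')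
  refine lt_of_le_of_lt ?_ (hsum.trans_le (min_le_left _ _))
  refine iInf_le_of_le t (iInf_le_of_le ht (iInf_le_of_le (fun n => ?_) ?_))
  · have h1 : Metric.ediam (t n) ^ s ≤ r ^ s :=
      (ENNReal.le_tsum (f := fun n => Metric.ediam (t n) ^ s) n).trans
        (hsum.le.trans (min_le_right _ _))
    exact (ENNReal.rpow_le_rpow_iff hs).1 h1
  · exact ENNReal.tsum_le_tsum fun n => iSup_le fun _ => le_rfl

theorem half_pow_rpow (k : ℕ) (s : ℝ) : ((1 / 2 : ℝ) ^ k) ^ s = ((1 / 2 : ℝ) ^ s) ^ k := by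
  rw [← Real.rpow_natCast, ← Real.rpow_natCast, ← Real.rpow_mul (by norm_num),
    ← Real.rpow_mul (by norm_num), mul_comm]

/-- A null set for the `s`-dimensional Hausdorff content has covers by sets with dyadic bounds
`2 ^ (-k n)` on the diameters, with `∑ 2 ^ (-s k n)` as small as desired. -/
theorem exists_dyadic_cover {X : Type*} [EMetricSpace X] {s : ℝ} (hs : 0 < s) {A : Set X}
    (h : hausdorffContent s A = 0) {ε : ENNReal} (hε : 0 < ε) :
    ∃ (t : ℕ → Set X) (k : ℕ → ℕ), A ⊆ ⋃ n, t n ∧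
      (∀ n, Metric.ediam (t n) ≤ ENNReal.ofReal ((1 / 2) ^ k n)) ∧
      ∑' n, ENNReal.ofReal (((1 / 2 : ℝ) ^ k n) ^ s) ≤ ε := by
  set b : ℝ := (1 / 2 : ℝ) ^ s with hb
  have hb0 : 0 < b := by positivity
  have hb1 : b < 1 := Real.rpow_lt_one (by norm_num) (by norm_num) hs
  have hbk : ∀ k : ℕ, ((1 / 2 : ℝ) ^ k) ^ s = b ^ k := fun k => half_pow_rpow k s
  -- half of the budget pays for the diameters, the other half keeps the bounds positive
  set η : ENNReal := min (1 / 2) (ENNReal.ofReal b * ε / 2) with hη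
  have hη0 : 0 < η := by
    refine lt_min (by simp) (ENNReal.div_pos ?_ (by simp))
    exact (ENNReal.mul_pos (by simpa using hb0) hε.ne').ne'
  obtain ⟨t, ht, hsum⟩ := exists_cover_of_hausdorffContent_lt hs (h ▸ hη0)
  obtain ⟨δ, hδ0, hδ⟩ := ENNReal.exists_pos_sum_of_countable' hη0.ne' ℕ
  have hy : ∀ n, ∃ k : ℕ, Metric.ediam (t n) ≤ ENNReal.ofReal ((1 / 2) ^ k) ∧
      ENNReal.ofReal b * ENNReal.ofReal (((1 / 2 : ℝ) ^ k) ^ s) ≤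
        Metric.ediam (t n) ^ s + δ n := by
    intro n
    have h1 : Metric.ediam (t n) ^ s + δ n ≤ 1 := by
      calc _ ≤ η + η := add_le_add ((ENNReal.le_tsum (f := fun n => Metric.ediam (t n) ^ s) n).trans
              hsum.le) ((ENNReal.le_tsum n).trans hδ.le)
        _ ≤ 1 / 2 + 1 / 2 := add_le_add (min_le_left _ _) (min_le_left _ _)
        _ = 1 := by simp [ENNReal.inv_two_add_inv_two]
    set y : ℝ := (Metric.ediam (t n) ^ s + δ n).toReal with hydef
    have hyt : Metric.ediam (t n) ^ s + δ n ≠ ⊤ := ne_top_of_le_ne_top (by simp) h1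
    have hyo : ENNReal.ofReal y = Metric.ediam (t n) ^ s + δ n := ENNReal.ofReal_toReal hyt
    have hy0 : 0 < y := ENNReal.toReal_pos (by simp [(hδ0 n).ne']) hyt
    have hy1 : y ≤ 1 := ENNReal.toReal_le_of_le_ofReal (by norm_num) (by simpa using h1)
    obtain ⟨k, hk1, hk2⟩ := exists_nat_pow_near_of_lt_one hy0 hy1 hb0 hb1
    refine ⟨k, ?_, ?_⟩
    · rw [← ENNReal.rpow_le_rpow_iff hs, ENNReal.ofReal_rpow_of_pos (by positivity), hbk]
      calc _ ≤ Metric.ediam (t n) ^ s + δ n := le_self_add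
        _ = ENNReal.ofReal y := hyo.symm
        _ ≤ _ := ENNReal.ofReal_le_ofReal hk2
    · rw [← hyo, hbk, ← ENNReal.ofReal_mul hb0.le, mul_comm, ← pow_succ]
      exact ENNReal.ofReal_le_ofReal hk1.le
  choose k hk1 hk2 using hy
  refine ⟨t, k, ht, hk1, ?_⟩
  have hb' : ENNReal.ofReal b ≠ 0 := by simpa using hb0
  rw [← ENNReal.mul_le_mul_iff_right hb' ENNReal.ofReal_ne_top, ← ENNReal.tsum_mul_left]
  calc _ ≤ ∑' n, (Metric.ediam (t n) ^ s + δ n) := ENNReal.tsum_le_tsum hk2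
    _ = _ := ENNReal.tsum_add
    _ ≤ η + η := add_le_add hsum.le hδ.le
    _ ≤ ENNReal.ofReal b * ε / 2 + ENNReal.ofReal b * ε / 2 :=
      add_le_add (min_le_right _ _) (min_le_right _ _)
    _ = _ := ENNReal.add_halves _

/-- Given finitely many capacity constraints such that every point occurs in one of them, there are
weights obeying all constraints for which every point lies in a saturated one. -/
theorem exists_saturated_weights {X ι : Type*} [DecidableEq X] (P : Finset X) (J : Finset ι)
    (C : ι → Finset X) (b : ι → ℝ) (hb : ∀ i ∈ J, 0 ≤ b i) (hcov : ∀ x ∈ P, ∃ i ∈ J, x ∈ C i) :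
    ∃ w : X → ℝ, (∀ x, 0 ≤ w x) ∧ (∀ i ∈ J, ∑ x ∈ C i, w x ≤ b i) ∧
      ∀ x ∈ P, ∃ i ∈ J, x ∈ C i ∧ ∑ x ∈ C i, w x = b i := by
  suffices H : ∃ w : X → ℝ, (∀ x, 0 ≤ w x) ∧ (∀ x ∉ P, w x = 0) ∧
      (∀ i ∈ J, ∑ x ∈ C i, w x ≤ b i) ∧ ∀ x ∈ P, ∃ i ∈ J, x ∈ C i ∧ ∑ x ∈ C i, w x = b i by
    obtain ⟨w, h1, -, h2⟩ := H
    exact ⟨w, h1, h2⟩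
  induction P using Finset.induction_on with
  | empty => exact ⟨fun _ => 0, by simp, by simp, by simpa using hb, by simp⟩
  | insert a P ha ih =>
    obtain ⟨w, hw0, hwP, hwb, hws⟩ := ih fun x hx => hcov x (Finset.mem_insert_of_mem hx)
    -- the new point receives the smallest slack among the constraints containing it
    obtain ⟨i₀, hi₀, hai₀⟩ := hcov a (Finset.mem_insert_self _ _)
    obtain ⟨j, hj, hmin⟩ := Finset.exists_min_image (J.filter fun i => a ∈ C i)
      (fun i => b i - ∑ x ∈ C i, w x) ⟨i₀, by simp [hi₀, hai₀]⟩
    simp only [Finset.mem_filter] at hj hmin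
    set m := b j - ∑ x ∈ C j, w x with hm
    have hm0 : 0 ≤ m := sub_nonneg.2 (hwb j hj.1)
    have hsum_in : ∀ i, a ∈ C i →
        ∑ x ∈ C i, Function.update w a m x = ∑ x ∈ C i, w x + m := by
      intro i hi
      rw [Finset.sum_update_of_mem hi, ← Finset.add_sum_erase _ _ hi, hwP a ha, zero_add, add_comm,
        Finset.sdiff_singleton_eq_erase]
    have hsum_out : ∀ i, a ∉ C i →
        ∑ x ∈ C i, Function.update w a m x = ∑ x ∈ C i, w x := fun i hi =>
      Finset.sum_update_of_notMem hi _ _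
    refine ⟨Function.update w a m, fun x => ?_, fun x hx => ?_, fun i hi => ?_, fun x hx => ?_⟩
    · rcases eq_or_ne x a with rfl | h
      · simpa using hm0
      · simpa [h] using hw0 x
    · simp only [Finset.mem_insert, not_or] at hx
      simpa [hx.1] using hwP x hx.2
    · by_cases hai : a ∈ C i
      · rw [hsum_in i hai]
        linarith [hmin i ⟨hi, hai⟩]
      · rw [hsum_out i hai]
        exact hwb i hi
    · rcases Finset.mem_insert.1 hx with rfl | hx
      · exact ⟨j, hj.1, hj.2, by rw [hsum_in j hj.2, hm]; ring⟩
      · obtain ⟨i, hi, hxi, hsat⟩ := hws x hx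
        refine ⟨i, hi, hxi, ?_⟩
        by_cases hai : a ∈ C i
        · have h1 := hmin i ⟨hi, hai⟩
          have h2 : m = 0 := by linarith
          rw [hsum_in i hai, h2, hsat, add_zero]
        · rw [hsum_out i hai, hsat]

/-- Finite Frostman lemma at scale `2 ^ (-k)`: a finite `2 ^ (-k)`-net of `A` carries weights that
are `s`-dimensional down to scale `2 ^ (-k)` and whose total mass bounds the content of `A`. Every
point of the net lies in a saturated ball; by Vitali's lemma, enlargements of disjoint saturated
balls cover `A`. -/
theorem exists_frostman_weights {X : Type*} [MetricSpace X] {s : ℝ} (hs : 0 < s) (k : ℕ)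
    (A : Set X) (P : Finset X) (hA : A ⊆ ⋃ x ∈ P, Metric.closedBall x ((1 / 2) ^ k)) :
    ∃ w : X → ℝ, (∀ x, 0 ≤ w x) ∧
      (∀ z ∈ P, ∀ l ≤ k, ∑ x ∈ P with dist x z ≤ (1 / 2) ^ l, w x ≤ ((1 / 2 : ℝ) ^ l) ^ s) ∧
      hausdorffContent s A ≤ ENNReal.ofReal (12 ^ s * ∑ x ∈ P, w x) := by
  classical
  set J := P ×ˢ Finset.range (k + 1) with hJ
  set C : X × ℕ → Finset X := fun i => P.filter fun x => dist x i.1 ≤ (1 / 2) ^ i.2 with hC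
  obtain ⟨w, hw0, hwb, hws⟩ := exists_saturated_weights P J C
    (fun i => ((1 / 2 : ℝ) ^ i.2) ^ s) (fun i _ => by positivity)
    (fun x hx => ⟨(x, 0), by simp [hJ, hx], by simp [hC, hx]⟩)
  refine ⟨w, hw0, fun z hz l hl => hwb (z, l) (by simp [hJ, hz]; omega), ?_⟩
  choose! f hfJ hfC hfs using hws
  obtain ⟨u, hu, hdisj, hcov⟩ := Vitali.exists_disjoint_subfamily_covering_enlargement_closedBall
    ((P.image f : Finset (X × ℕ)) : Set (X × ℕ)) Prod.fst (fun i => (1 / 2 : ℝ) ^ i.2) 1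
    (fun i _ => pow_le_one₀ (by norm_num) (by norm_num)) 5 (by norm_num)
  have hufin : u.Finite := (Finset.finite_toSet _).subset hu
  obtain ⟨U, rfl⟩ := hufin.exists_finset_coe
  have hUs : ∀ i ∈ U, i ∈ J ∧ ∑ x ∈ C i, w x = ((1 / 2 : ℝ) ^ i.2) ^ s := by
    intro i hi
    obtain ⟨x, hx, rfl⟩ := Finset.mem_image.1 (hu hi)
    exact ⟨hfJ x hx, hfs x hx⟩
  have hAU : A ⊆ ⋃ i ∈ U, Metric.closedBall i.1 (6 * (1 / 2) ^ i.2) := by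
    intro a ha
    obtain ⟨x, hx, hax⟩ := mem_iUnion₂.1 (hA ha)
    obtain ⟨i, hi, hsub⟩ := hcov (f x) (by simpa using ⟨x, hx, rfl⟩)
    have hxi : x ∈ Metric.closedBall i.1 (5 * (1 / 2) ^ i.2) :=
      hsub (by simpa [hC] using (Finset.mem_filter.1 (hfC x hx)).2)
    refine mem_iUnion₂.2 ⟨i, hi, ?_⟩
    have hik : i.2 ≤ k := by
      have := (Finset.mem_product.1 (hUs i hi).1).2
      simp at this; omega
    have hp : (1 / 2 : ℝ) ^ k ≤ (1 / 2) ^ i.2 :=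
      pow_le_pow_of_le_one (by norm_num) (by norm_num) hik
    rw [Metric.mem_closedBall] at *
    linarith [dist_triangle a x i.1]
  have hdisjC : Set.PairwiseDisjoint (U : Set (X × ℕ)) C := by
    intro i hi j hj hij
    rw [Function.onFun, Finset.disjoint_left]
    intro x hxi hxj
    exact Set.disjoint_left.1 (hdisj hi hj hij) (by simpa using (Finset.mem_filter.1 hxi).2)
      (by simpa using (Finset.mem_filter.1 hxj).2)
  calc hausdorffContent s A
      ≤ ∑ i ∈ U, hausdorffContent s (Metric.closedBall i.1 (6 * (1 / 2) ^ i.2)) :=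
        (measure_mono hAU).trans (measure_biUnion_finset_le _ _)
    _ ≤ ∑ i ∈ U, ENNReal.ofReal (12 ^ s * ∑ x ∈ C i, w x) := by
        refine Finset.sum_le_sum fun i hi => (hausdorffContent_le_ediam _ _).trans ?_
        rw [(hUs i hi).2, ← Real.mul_rpow (by norm_num) (by positivity),
          ← ENNReal.ofReal_rpow_of_pos (by positivity)]
        refine ENNReal.rpow_le_rpow ?_ hs.le
        refine Metric.ediam_le_of_forall_dist_le fun x hx y hy => ?_
        rw [Metric.mem_closedBall] at hx hy
        linarith [dist_triangle_right x y i.1]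
    _ = ENNReal.ofReal (12 ^ s * ∑ i ∈ U, ∑ x ∈ C i, w x) := by
        rw [Finset.mul_sum, ENNReal.ofReal_sum_of_nonneg]
        exact fun i _ => mul_nonneg (by positivity) (Finset.sum_nonneg fun x _ => hw0 x)
    _ ≤ _ := by
        refine ENNReal.ofReal_le_ofReal (mul_le_mul_of_nonneg_left ?_ (by positivity))
        rw [← Finset.sum_biUnion hdisjC]
        refine Finset.sum_le_sum_of_subset_of_nonneg ?_ fun x _ _ => hw0 x
        exact Finset.biUnion_subset.2 fun i _ => Finset.filter_subset _ _

/-! ### Curved graphs and the parameters of close points on two translates -/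

/-- Over `[p, q]`, the map `G` parametrizes a graph by its `i`-th coordinate. The other coordinate
`j` is a Lipschitz function of it which is uniformly convex or uniformly concave, expressed by the
lower bound `c * |h| * |a - b|` for second differences. -/
structure IsCurvedGraph (i j : Fin 2) (G : ℝ → Plane) (p q L c : ℝ) : Prop where
  lt : p < q
  ne : i ≠ j
  c_pos : 0 < c
  L_pos : 0 < L
  continuous : Continuous G
  apply_eq : ∀ a ∈ Icc p q, G a i = a
  lipschitz : ∀ a ∈ Icc p q, ∀ b ∈ Icc p q, ‖G a - G b‖ ≤ L * |a - b|
  curved : ∀ a b h, a ∈ Icc p q → b ∈ Icc p q → a + h ∈ Icc p q → b + h ∈ Icc p q →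
    c * |h| * |a - b| ≤ |(G (a + h) j - G a j) - (G (b + h) j - G b j)|

theorem abs_apply_le_norm (x : Plane) (i : Fin 2) : |x i| ≤ ‖x‖ := by
  simpa using PiLp.norm_apply_le x i

/-- The pairs of parameters `(b, a)` in `[p, q]` for which `z + G a` and `G b` are `r`-close. -/
def closePairs (G : ℝ → Plane) (p q : ℝ) (z : Plane) (r : ℝ) : Set (ℝ × ℝ) :=
  {x | x.1 ∈ Icc p q ∧ x.2 ∈ Icc p q ∧ ‖z + G x.2 - G x.1‖ ≤ r}

namespace IsCurvedGraph

variable {i j : Fin 2} {G : ℝ → Plane} {p q L c : ℝ}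

theorem isClosed_closePairs (hG : IsCurvedGraph i j G p q L c) (z : Plane) (r : ℝ) :
    IsClosed (closePairs G p q z r) := by
  have := hG.continuous
  have h : IsClosed {x : ℝ × ℝ | ‖z + G x.2 - G x.1‖ ≤ r} :=
    isClosed_le (by fun_prop) continuous_const
  exact (isClosed_Icc.preimage continuous_fst).inter ((isClosed_Icc.preimage continuous_snd).inter h)

/-- In the coordinates `(b, h) = (b, a - b)`, closeness in the `i`-th coordinate confines `h` to an
interval of length `2 * r`. -/
theorem volume_closePairs_le (hG : IsCurvedGraph i j G p q L c) (z : Plane) {r D : ℝ}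
    (hr : 0 ≤ r)
    (hD : ∀ h, volume {b | (b, b + h) ∈ closePairs G p q z r} ≤ ENNReal.ofReal D) :
    volume (closePairs G p q z r) ≤ ENNReal.ofReal (2 * r * D) := by
  have hmeas := (hG.isClosed_closePairs z r).measurableSet
  have hmp := measurePreserving_prod_add (volume : Measure ℝ) (volume : Measure ℝ)
  rw [Measure.volume_eq_prod, ← hmp.measure_preimage hmeas.nullMeasurableSet,
    Measure.prod_apply_symm (hmp.measurable hmeas)]
  have hzero : ∀ h, h ∉ Icc (-z i - r) (-z i + r) →
      volume {b | (b, b + h) ∈ closePairs G p q z r} = 0 := by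
    intro h hh
    have : {b | (b, b + h) ∈ closePairs G p q z r} = ∅ := by
      refine eq_empty_of_forall_notMem fun b ⟨hb, hbh, hle⟩ => hh ?_
      have h1 := (abs_apply_le_norm _ i).trans hle
      have h2 : (z + G (b + h) - G b) i = z i + h := by
        simp only [PiLp.sub_apply, PiLp.add_apply, hG.apply_eq _ hb, hG.apply_eq _ hbh]
        ring
      simp only [h2, abs_le] at h1
      constructor <;> linarith [h1.1, h1.2]
    rw [this, measure_empty]
  calc _ ≤ ∫⁻ h, (Icc (-z i - r) (-z i + r)).indicator (fun _ => ENNReal.ofReal D) h := by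
        refine lintegral_mono fun h => ?_
        by_cases hh : h ∈ Icc (-z i - r) (-z i + r)
        · rw [indicator_of_mem hh]
          exact hD h
        · rw [indicator_of_notMem hh]
          exact (hzero h hh).le
    _ = ENNReal.ofReal (2 * r * D) := by
        rw [lintegral_indicator measurableSet_Icc, setLIntegral_const, Real.volume_Icc, mul_comm,
          ← ENNReal.ofReal_mul (by linarith)]
        congr 2; ring

theorem volume_closePairs_le_linear (hG : IsCurvedGraph i j G p q L c) (z : Plane) {r : ℝ}
    (hr : 0 ≤ r) : volume (closePairs G p q z r) ≤ ENNReal.ofReal (2 * r * (q - p)) := by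
  refine hG.volume_closePairs_le z hr fun h => ?_
  rw [← Real.volume_Icc]
  exact measure_mono fun b hb => hb.1

/-- Transversality of `z + G` and `G`: far translates are close to each other only on a small set
of pairs of parameters. -/
theorem volume_closePairs_le_div (hG : IsCurvedGraph i j G p q L c) {z : Plane} {r : ℝ}
    (hr : 0 ≤ r) (hz : z ≠ 0) :
    volume (closePairs G p q z r) ≤
      ENNReal.ofReal ((4 * (q - p) + 8 * L / c) * r ^ 2 / ‖z‖) := by
  have hz0 : 0 < ‖z‖ := norm_pos_iff.2 hz
  have hc := hG.c_pos
  have hL := hG.L_pos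
  have hpq := sub_pos.2 hG.lt
  rcases lt_or_ge ‖z‖ (2 * r) with hzr | hzr
  · refine (hG.volume_closePairs_le_linear z hr).trans (ENNReal.ofReal_le_ofReal ?_)
    rw [le_div_iff₀ hz0]
    have h1 : 2 * r * (q - p) * ‖z‖ ≤ 2 * r * (q - p) * (2 * r) := by gcongr
    have h2 : 0 ≤ 8 * L / c * r ^ 2 := by positivity
    nlinarith
  · refine (hG.volume_closePairs_le z hr (D := 4 * r * L / (c * ‖z‖)) fun h => ?_).trans
      (ENNReal.ofReal_le_ofReal ?_)
    · refine (Real.volume_le_diam _).trans ?_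
      refine Metric.ediam_le_of_forall_dist_le fun a ⟨ha, hah, hale⟩ b ⟨hb, hbh, hble⟩ => ?_
      simp only at ha hah hale hb hbh hble
      rw [Real.dist_eq]
      have h1 := hG.curved a b h ha hb hah hbh
      have h2 := (abs_apply_le_norm _ j).trans hale
      have h3 := (abs_apply_le_norm _ j).trans hble
      simp only [PiLp.sub_apply, PiLp.add_apply] at h2 h3
      have h4 : c * |h| * |a - b| ≤ 2 * r := by
        refine h1.trans ?_
        rw [abs_le] at *
        constructor <;> linarith [h2.1, h2.2, h3.1, h3.2]
      -- `z` is far from the origin, so the parameters cannot be close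
      have h5 : ‖z‖ ≤ 2 * L * |h| := by
        have h6 := hG.lipschitz _ hah _ ha
        have h7 : ‖z‖ ≤ ‖z + G (a + h) - G a‖ + ‖G (a + h) - G a‖ := by
          have := norm_sub_le (z + G (a + h) - G a) (G (a + h) - G a)
          have h8 : z + G (a + h) - G a - (G (a + h) - G a) = z := by abel
          rwa [h8] at this
        have h8 : a + h - a = h := by ring
        rw [h8] at h6
        linarith
      rw [le_div_iff₀ (by positivity)]
      calc |a - b| * (c * ‖z‖) ≤ |a - b| * (c * (2 * L * |h|)) := by gcongr
        _ = 2 * L * (c * |h| * |a - b|) := by ring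
        _ ≤ 2 * L * (2 * r) := by gcongr
        _ = _ := by ring
    · have h1 : 2 * r * (4 * r * L / (c * ‖z‖)) = 8 * L / c * r ^ 2 / ‖z‖ := by
        field_simp
        ring
      rw [h1]
      have h2 : 0 ≤ 4 * (q - p) := by positivity
      gcongr
      linarith

/-- A bound for the measure of `closePairs` at scale `2 ^ (-k)` as a sum over the dyadic balls that
contain `z`. -/
theorem volume_real_closePairs_le (hG : IsCurvedGraph i j G p q L c) {z : Plane} (hz : ‖z‖ ≤ 1)
    (k : ℕ) :
    volume.real (closePairs G p q z ((1 / 2) ^ k)) ≤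
      2 * (4 * (q - p) + 8 * L / c) * ((1 / 2) ^ k) ^ 2 *
        ∑ l ∈ Finset.range (k + 1), if ‖z‖ ≤ (1 / 2) ^ l then (2 : ℝ) ^ l else 0 := by
  have hc := hG.c_pos
  have hL := hG.L_pos
  have hpq := sub_pos.2 hG.lt
  set K := 4 * (q - p) + 8 * L / c with hK
  have hK1 : 0 ≤ 8 * L / c := by positivity
  have hK0 : 0 ≤ K := by positivity
  -- it suffices to consider the smallest dyadic ball containing `z`
  have key : ∀ l ≤ k, ‖z‖ ≤ (1 / 2) ^ l →
      volume.real (closePairs G p q z ((1 / 2) ^ k)) ≤ 2 * K * ((1 / 2) ^ k) ^ 2 * 2 ^ l →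
      volume.real (closePairs G p q z ((1 / 2) ^ k)) ≤ 2 * K * ((1 / 2) ^ k) ^ 2 *
        ∑ l ∈ Finset.range (k + 1), if ‖z‖ ≤ (1 / 2) ^ l then (2 : ℝ) ^ l else 0 := by
    intro l hl hzl h
    refine h.trans (mul_le_mul_of_nonneg_left ?_ (by positivity))
    have := Finset.single_le_sum (f := fun l => if ‖z‖ ≤ (1 / 2) ^ l then (2 : ℝ) ^ l else 0)
      (s := Finset.range (k + 1)) (fun l _ => by positivity)
      (Finset.mem_range.2 (Nat.lt_succ_of_le hl))
    simp only [if_pos hzl] at this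
    exact this
  by_cases hzk : ‖z‖ ≤ (1 / 2) ^ k
  · refine key k le_rfl hzk ?_
    refine ENNReal.toReal_le_of_le_ofReal (by positivity)
      ((hG.volume_closePairs_le_linear z (by positivity)).trans (ENNReal.ofReal_le_ofReal ?_))
    have h1 : ((1 / 2 : ℝ) ^ k) ^ 2 * 2 ^ k = (1 / 2) ^ k := by
      rw [sq, mul_assoc, ← mul_pow]; norm_num
    rw [mul_assoc (2 * K), h1]
    have : 0 < (1 / 2 : ℝ) ^ k := by positivity
    nlinarith
  · have hz0 : 0 < ‖z‖ := lt_of_le_of_lt (by positivity) (not_le.1 hzk)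
    obtain ⟨l, hl1, hl2⟩ := exists_nat_pow_near_of_lt_one hz0 hz
      (by norm_num : (0 : ℝ) < 1 / 2) (by norm_num)
    have hlk : l ≤ k := by
      by_contra hlk
      exact hzk (hl2.trans (pow_le_pow_of_le_one (by norm_num) (by norm_num) (by omega)))
    refine key l hlk hl2 ?_
    refine ENNReal.toReal_le_of_le_ofReal (by positivity)
      ((hG.volume_closePairs_le_div (by positivity) (norm_pos_iff.1 hz0)).trans
        (ENNReal.ofReal_le_ofReal ?_))
    rw [div_le_iff₀ hz0]
    have h1 : (1 : ℝ) ≤ 2 * 2 ^ l * ‖z‖ := by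
      have : (2 : ℝ) * 2 ^ l * (1 / 2) ^ (l + 1) = 1 := by
        rw [← pow_succ', ← mul_pow]; norm_num
      rw [← this]
      gcongr
    have h2 : 0 ≤ K * ((1 / 2) ^ k) ^ 2 := by positivity
    nlinarith [mul_le_mul_of_nonneg_left h1 h2]

end IsCurvedGraph

/-! ### The single-scale content estimate -/

theorem exists_disjoint_measurable_refinement {α ι : Type*} [MeasurableSpace α] (M : Finset ι)
    (F : ι → Set α) (hF : ∀ m ∈ M, MeasurableSet (F m)) :
    ∃ D : ι → Set α, (∀ m ∈ M, MeasurableSet (D m) ∧ D m ⊆ F m) ∧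
      (M : Set ι).PairwiseDisjoint D ∧ ⋃ m ∈ M, F m = ⋃ m ∈ M, D m := by
  classical
  induction M using Finset.induction_on with
  | empty => exact ⟨F, by simp⟩
  | insert a M ha ih =>
    obtain ⟨D, hD, hdisj, hU⟩ := ih fun m hm => hF m (Finset.mem_insert_of_mem hm)
    have hDa : ∀ m ∈ M, Function.update D a (F a \ ⋃ m ∈ M, F m) m = D m := fun m hm =>
      Function.update_of_ne (ne_of_mem_of_not_mem hm ha) _ _
    refine ⟨Function.update D a (F a \ ⋃ m ∈ M, F m), ?_, ?_, ?_⟩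
    · intro m hm
      rcases Finset.mem_insert.1 hm with rfl | hm
      · rw [Function.update_self]
        exact ⟨(hF _ hm).diff (Finset.measurableSet_biUnion _ fun i hi =>
          hF i (Finset.mem_insert_of_mem hi)), sdiff_subset⟩
      · rw [hDa m hm]
        exact hD m hm
    · have h1 : ∀ m ∈ M, Disjoint (F a \ ⋃ m ∈ M, F m) (D m) := fun m hm => by
        rw [hU]
        exact disjoint_sdiff_left.mono_right (subset_biUnion_of_mem (u := D) hm)
      rw [Finset.coe_insert]
      refine Set.PairwiseDisjoint.insert_of_notMem ?_ (by simpa using ha) ?_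
      · intro x hx y hy hxy
        rw [Function.onFun, hDa x hx, hDa y hy]
        exact hdisj hx hy hxy
      · intro m hm
        rw [Function.update_self, hDa m hm]
        exact h1 m hm
    · rw [Finset.set_biUnion_insert, Finset.set_biUnion_insert, Function.update_self,
        iUnion₂_congr hDa, ← hU, sdiff_union_self]

namespace IsCurvedGraph

variable {i j : Fin 2} {G : ℝ → Plane} {p q L c : ℝ}

/-- Disjoint small sets `D m` receive only close pairs of points of the two translates `x + G`
and `y + G`. -/
theorem sum_volume_mul_volume_le (hG : IsCurvedGraph i j G p q L c) {ι : Type*} (M : Finset ι)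
    (D : ι → Set Plane) {r : ℝ} (hD : ∀ m ∈ M, MeasurableSet (D m))
    (hdisj : (M : Set ι).PairwiseDisjoint D)
    (hdiam : ∀ m ∈ M, ∀ x ∈ D m, ∀ y ∈ D m, dist x y ≤ r) (x y : Plane) :
    ∑ m ∈ M, volume.real (Icc p q ∩ (fun a => y + G a) ⁻¹' D m) *
      volume.real (Icc p q ∩ (fun a => x + G a) ⁻¹' D m) ≤
      volume.real (closePairs G p q (x - y) r) := by
  have hm : ∀ m ∈ M, ∀ z : Plane, MeasurableSet (Icc p q ∩ (fun a => z + G a) ⁻¹' D m) :=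
    fun m hm z => measurableSet_Icc.inter
      ((continuous_const.add hG.continuous).measurable (hD m hm))
  have hfin : volume (closePairs G p q (x - y) r) ≠ ⊤ := by
    refine ne_top_of_le_ne_top ?_ (measure_mono (t := Icc p q ×ˢ Icc p q) fun u hu => ⟨hu.1, hu.2.1⟩)
    rw [Measure.volume_eq_prod, Measure.prod_prod, Real.volume_Icc]
    exact ENNReal.mul_ne_top ENNReal.ofReal_ne_top ENNReal.ofReal_ne_top
  set S : ι → Set (ℝ × ℝ) := fun m => (Icc p q ∩ (fun a => y + G a) ⁻¹' D m) ×ˢ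
    (Icc p q ∩ (fun a => x + G a) ⁻¹' D m) with hS
  have hSsub : ⋃ m ∈ M, S m ⊆ closePairs G p q (x - y) r := by
    refine iUnion₂_subset fun m hm u hu => ⟨hu.1.1, hu.2.1, ?_⟩
    have h := hdiam m hm _ hu.2.2 _ hu.1.2
    rw [dist_eq_norm] at h
    have h' : x - y + G u.2 - G u.1 = x + G u.2 - (y + G u.1) := by abel
    rwa [← h'] at h
  calc _ = ∑ m ∈ M, volume.real (S m) := by
        refine Finset.sum_congr rfl fun m _ => ?_
        rw [hS, Measure.volume_eq_prod, measureReal_prod_prod]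
    _ = volume.real (⋃ m ∈ M, S m) := by
        refine (measureReal_biUnion_finset ?_ ?_ ?_).symm
        · intro a ha b hb hab
          rw [Function.onFun, Set.disjoint_left]
          exact fun u hu hu' => Set.disjoint_left.1 (hdisj ha hb hab) hu.1.2 hu'.1.2
        · exact fun m hm' => (hm m hm' y).prod (hm m hm' x)
        · exact fun m hm => ne_top_of_le_ne_top hfin
            (measure_mono ((subset_biUnion_of_mem (u := S) hm).trans hSsub))
    _ ≤ _ := measureReal_mono hSsub hfin

/-- The single-scale estimate: if, for each `x` in `A`, the translate `x + G` spends time at least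
`e` in a union of `#M` sets of diameter at most `2 ^ (-k)`, then the content of `A` is small. -/
theorem hausdorffContent_le_single_scale (hG : IsCurvedGraph i j G p q L c) {s τ B : ℝ}
    (hs : 0 < s)
    (hB : ∀ k : ℕ, ((1 / 2 : ℝ) ^ k) ^ 2 *
      ∑ l ∈ Finset.range (k + 1), 2 ^ l * ((1 / 2 : ℝ) ^ l) ^ s ≤ B * ((1 / 2 : ℝ) ^ k) ^ τ) :
    ∃ C : ℝ, 0 ≤ C ∧ ∀ (A : Set Plane), (∀ x ∈ A, ∀ y ∈ A, dist x y ≤ 1) →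
      ∀ (k : ℕ) {ι : Type} (M : Finset ι) (F : ι → Set Plane), (∀ m ∈ M, IsClosed (F m)) →
      (∀ m ∈ M, ∀ x ∈ F m, ∀ y ∈ F m, dist x y ≤ (1 / 2) ^ k) → ∀ e : ℝ, 0 < e →
      (∀ x ∈ A, ENNReal.ofReal e ≤ volume (Icc p q ∩ (fun a => x + G a) ⁻¹' ⋃ m ∈ M, F m)) →
      hausdorffContent s A ≤ ENNReal.ofReal (C * (M.card * ((1 / 2 : ℝ) ^ k) ^ τ) / e ^ 2) := by
  have hc := hG.c_pos
  have hL := hG.L_pos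
  have hpq := sub_pos.2 hG.lt
  set K := 2 * (4 * (q - p) + 8 * L / c) with hK
  have hK0 : 0 ≤ K := by positivity
  have hB0 : 0 ≤ B := by
    have := hB 0
    simp at this
    linarith
  refine ⟨12 ^ s * (K * B), by positivity, ?_⟩
  intro A hA k ι M F hF hdiam e he hAe
  classical
  have htb : TotallyBounded A := by
    refine TotallyBounded.subset subset_closure (Bornology.IsBounded.isCompact_closure
      (Metric.isBounded_iff.2 ⟨1, ?_⟩)).totallyBounded
    exact fun x hx y hy => hA x hx y hy
  obtain ⟨P, hPA, hPfin, hAP⟩ := Metric.finite_approx_of_totallyBounded htb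
    ((1 / 2) ^ k) (by positivity)
  obtain ⟨P, rfl⟩ := hPfin.exists_finset_coe
  obtain ⟨w, hw0, hwb, hcont⟩ := exists_frostman_weights hs k A P
    (hAP.trans (iUnion₂_mono fun x _ => Metric.ball_subset_closedBall))
  obtain ⟨D, hD, hdisj, hDU⟩ := exists_disjoint_measurable_refinement M F
    fun m hm => (hF m hm).measurableSet
  set W := ∑ x ∈ P, w x with hW
  have hW0 : 0 ≤ W := Finset.sum_nonneg fun x _ => hw0 x
  refine hcont.trans (ENNReal.ofReal_le_ofReal ?_)
  set T : Plane → ι → ℝ := fun x m => volume.real (Icc p q ∩ (fun a => x + G a) ⁻¹' D m) with hT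
  have h1 : ∀ x ∈ P, e ≤ ∑ m ∈ M, T x m := by
    intro x hx
    have h2 : ENNReal.ofReal e ≤ ∑ m ∈ M, volume (Icc p q ∩ (fun a => x + G a) ⁻¹' D m) := by
      refine (hAe x (hPA hx)).trans ?_
      rw [hDU, preimage_iUnion₂, inter_iUnion₂]
      exact measure_biUnion_finset_le _ _
    have h3 : ∀ m, volume (Icc p q ∩ (fun a => x + G a) ⁻¹' D m) ≠ ⊤ := fun m =>
      ne_top_of_le_ne_top (by simp) (measure_mono (inter_subset_left (s := Icc p q)))
    have h4 := ENNReal.toReal_mono (ENNReal.sum_ne_top.2 fun m _ => h3 m) h2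
    rwa [ENNReal.toReal_ofReal he.le, ENNReal.toReal_sum fun m _ => h3 m] at h4
  have h2 : e * W ≤ ∑ m ∈ M, ∑ x ∈ P, w x * T x m := by
    rw [Finset.sum_comm, hW, Finset.mul_sum]
    refine Finset.sum_le_sum fun x hx => ?_
    rw [← Finset.mul_sum, mul_comm]
    exact mul_le_mul_of_nonneg_left (h1 x hx) (hw0 x)
  -- Cauchy–Schwarz over the `#M` sets
  have h3 : (e * W) ^ 2 ≤ M.card * ∑ m ∈ M, (∑ x ∈ P, w x * T x m) ^ 2 :=
    (pow_le_pow_left₀ (by positivity) h2 2).trans sq_sum_le_card_mul_sum_sq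
  have h4 : ∑ m ∈ M, (∑ x ∈ P, w x * T x m) ^ 2 =
      ∑ y ∈ P, ∑ x ∈ P, w y * w x * ∑ m ∈ M, T y m * T x m := by
    simp_rw [sq, Finset.sum_mul_sum, Finset.mul_sum]
    rw [Finset.sum_comm]
    refine Finset.sum_congr rfl fun y _ => ?_
    rw [Finset.sum_comm]
    exact Finset.sum_congr rfl fun x _ => Finset.sum_congr rfl fun m _ => by ring
  have h5 : ∀ y ∈ P, ∑ x ∈ P, w y * w x * ∑ m ∈ M, T y m * T x m ≤
      w y * (K * (B * ((1 / 2 : ℝ) ^ k) ^ τ)) := by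
    intro y hy
    calc _ ≤ ∑ x ∈ P, w y * w x * (K * ((1 / 2) ^ k) ^ 2 * ∑ l ∈ Finset.range (k + 1),
            if ‖x - y‖ ≤ (1 / 2) ^ l then (2 : ℝ) ^ l else 0) := by
          refine Finset.sum_le_sum fun x hx => mul_le_mul_of_nonneg_left ?_
            (mul_nonneg (hw0 y) (hw0 x))
          refine (hG.sum_volume_mul_volume_le M D (fun m hm => (hD m hm).1) hdisj
            (fun m hm u hu v hv => hdiam m hm u ((hD m hm).2 hu) v ((hD m hm).2 hv)) x y).trans ?_
          refine hG.volume_real_closePairs_le ?_ k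
          rw [← dist_eq_norm]
          exact hA x (hPA hx) y (hPA hy)
      _ = w y * (K * (((1 / 2) ^ k) ^ 2 * ∑ l ∈ Finset.range (k + 1),
            2 ^ l * ∑ x ∈ P with dist x y ≤ (1 / 2) ^ l, w x)) := by
          simp_rw [Finset.mul_sum, Finset.sum_filter, dist_eq_norm]
          rw [Finset.sum_comm]
          refine Finset.sum_congr rfl fun l _ => ?_
          refine Finset.sum_congr rfl fun x _ => ?_
          split_ifs <;> ring
      _ ≤ w y * (K * (((1 / 2) ^ k) ^ 2 * ∑ l ∈ Finset.range (k + 1),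
            2 ^ l * ((1 / 2 : ℝ) ^ l) ^ s)) := by
          refine mul_le_mul_of_nonneg_left (mul_le_mul_of_nonneg_left (mul_le_mul_of_nonneg_left
            (Finset.sum_le_sum fun l hl => mul_le_mul_of_nonneg_left ?_ (by positivity))
            (by positivity)) hK0) (hw0 y)
          exact hwb y hy l (Nat.lt_succ_iff.1 (Finset.mem_range.1 hl))
      _ ≤ _ := mul_le_mul_of_nonneg_left (mul_le_mul_of_nonneg_left (hB k) hK0) (hw0 y)
  have h6 : (e * W) ^ 2 ≤ M.card * (W * (K * (B * ((1 / 2 : ℝ) ^ k) ^ τ))) := by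
    refine h3.trans (mul_le_mul_of_nonneg_left ?_ (Nat.cast_nonneg _))
    rw [h4, hW, Finset.sum_mul]
    exact Finset.sum_le_sum h5
  rw [le_div_iff₀ (by positivity)]
  rcases hW0.eq_or_lt with h0 | h0
  · rw [← h0]
    simp only [mul_zero, zero_mul]
    positivity
  · have h7 : W * e ^ 2 ≤ M.card * (K * (B * ((1 / 2 : ℝ) ^ k) ^ τ)) := by
      refine le_of_mul_le_mul_left ?_ h0
      calc W * (W * e ^ 2) = (e * W) ^ 2 := by ring
        _ ≤ _ := h6
        _ = _ := by ring
    calc 12 ^ s * W * e ^ 2 = 12 ^ s * (W * e ^ 2) := by ring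
      _ ≤ 12 ^ s * (M.card * (K * (B * ((1 / 2 : ℝ) ^ k) ^ τ))) := by gcongr
      _ = _ := by ring

end IsCurvedGraph

/-! ### Content estimates from covers at many scales -/

theorem eq_zero_of_forall_le_ofReal_mul {c : ENNReal} {C : ℝ}
    (h : ∀ ε : ℝ, 0 < ε → c ≤ ENNReal.ofReal (C * ε)) : c = 0 := by
  have h1 : Filter.Tendsto (fun ε : ℝ => ENNReal.ofReal (C * ε)) (nhdsWithin 0 (Ioi 0))
      (nhds (ENNReal.ofReal (C * 0))) := by
    have : Continuous fun ε : ℝ => ENNReal.ofReal (C * ε) :=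
      ENNReal.continuous_ofReal.comp (by fun_prop)
    exact (this.tendsto 0).mono_left nhdsWithin_le_nhds
  have h2 := ge_of_tendsto h1 (Filter.eventually_of_mem self_mem_nhdsWithin fun ε hε => h ε hε)
  simpa using h2

/-- With the `s`-dimensional bound `2 ^ (-l s)` for the mass of a ball of radius `2 ^ (-l)`, the left
side bounds the energy of the translates at scale `2 ^ (-k)`. For `s < 1` the smallest balls
dominate. -/
theorem sum_dyadic_le_of_lt_one {s : ℝ} (hs : s < 1) : ∃ B : ℝ, ∀ k : ℕ,
    ((1 / 2 : ℝ) ^ k) ^ 2 * ∑ l ∈ Finset.range (k + 1), 2 ^ l * ((1 / 2 : ℝ) ^ l) ^ s ≤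
      B * ((1 / 2 : ℝ) ^ k) ^ (1 + s) := by
  set ρ : ℝ := 2 * (1 / 2) ^ s with hρ
  have hρ1 : 1 < ρ := by
    have h := Real.rpow_lt_rpow_of_exponent_gt (by norm_num : (0 : ℝ) < 1 / 2) (by norm_num) hs
    rw [Real.rpow_one] at h
    linarith
  refine ⟨ρ / (ρ - 1), fun k => ?_⟩
  have h1 : ∀ l : ℕ, 2 ^ l * ((1 / 2 : ℝ) ^ l) ^ s = ρ ^ l := fun l => by
    rw [half_pow_rpow, ← mul_pow]
  simp_rw [h1]
  rw [geom_sum_eq hρ1.ne', half_pow_rpow, Real.rpow_add (by norm_num), Real.rpow_one]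
  have h2 : (1 / 2 * (1 / 2 : ℝ) ^ s) ^ k = ((1 / 2 : ℝ) ^ k) ^ 2 * ρ ^ k := by
    rw [hρ, ← pow_mul, mul_comm k 2, pow_mul, ← mul_pow]
    congr 1
    ring
  rw [h2, div_mul_eq_mul_div, ← mul_div_assoc]
  have h3 : 0 < ρ - 1 := by linarith
  rw [div_le_div_iff_of_pos_right h3, pow_succ ρ]
  nlinarith [sq_nonneg ((1 / 2 : ℝ) ^ k)]

/-- The counterpart of `sum_dyadic_le_of_lt_one` for `1 < s`, where the largest balls dominate. -/
theorem sum_dyadic_le_of_one_lt {s : ℝ} (hs : 1 < s) : ∃ B : ℝ, ∀ k : ℕ,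
    ((1 / 2 : ℝ) ^ k) ^ 2 * ∑ l ∈ Finset.range (k + 1), 2 ^ l * ((1 / 2 : ℝ) ^ l) ^ s ≤
      B * ((1 / 2 : ℝ) ^ k) ^ (2 : ℝ) := by
  set ρ : ℝ := 2 * (1 / 2) ^ s with hρ
  have hρ0 : 0 ≤ ρ := by positivity
  have hρ1 : ρ < 1 := by
    have h := Real.rpow_lt_rpow_of_exponent_gt (by norm_num : (0 : ℝ) < 1 / 2) (by norm_num) hs
    rw [Real.rpow_one] at h
    linarith
  refine ⟨(1 - ρ)⁻¹, fun k => ?_⟩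
  have h1 : ∀ l : ℕ, 2 ^ l * ((1 / 2 : ℝ) ^ l) ^ s = ρ ^ l := fun l => by
    rw [half_pow_rpow, ← mul_pow]
  simp_rw [h1]
  rw [Real.rpow_two, mul_comm]
  gcongr
  rw [← tsum_geometric_of_lt_one hρ0 hρ1]
  exact (summable_geometric_of_lt_one hρ0 hρ1).sum_le_tsum _ fun l _ => by positivity

namespace IsCurvedGraph

variable {i j : Fin 2} {G : ℝ → Plane} {p q L c : ℝ}

/-- The single-scale estimates add up: if all translates of `G` by points of `A` are covered by
countably many families of sets, the `n`-th at the scale `2 ^ (-k n)` and with geometrically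
decreasing total size, then the content of `A` is small. -/
theorem hausdorffContent_le_multi_scale (hG : IsCurvedGraph i j G p q L c) {s τ B σ : ℝ}
    (hs : 0 < s)
    (hB : ∀ k : ℕ, ((1 / 2 : ℝ) ^ k) ^ 2 *
      ∑ l ∈ Finset.range (k + 1), 2 ^ l * ((1 / 2 : ℝ) ^ l) ^ s ≤ B * ((1 / 2 : ℝ) ^ k) ^ τ)
    (hσ0 : 0 < σ) (hσ1 : σ < 1) :
    ∃ C : ℝ, 0 ≤ C ∧ ∀ (A : Set Plane), (∀ x ∈ A, ∀ y ∈ A, dist x y ≤ 1) →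
      ∀ (ε : ℝ), 0 ≤ ε → ∀ (k : ℕ → ℕ) {ι : Type} (M : ℕ → Finset ι) (F : ℕ → ι → Set Plane),
      (∀ n, ∀ m ∈ M n, IsClosed (F n m)) →
      (∀ n, ∀ m ∈ M n, ∀ x ∈ F n m, ∀ y ∈ F n m, dist x y ≤ (1 / 2) ^ k n) →
      (∀ n, (M n).card * ((1 / 2 : ℝ) ^ k n) ^ τ ≤ ε * (σ ^ n) ^ 4) →
      (∀ x ∈ A, ∀ a ∈ Icc p q, x + G a ∈ ⋃ n, ⋃ m ∈ M n, F n m) →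
      hausdorffContent s A ≤ ENNReal.ofReal (C * ε) := by
  obtain ⟨C, hC0, hC⟩ := hG.hausdorffContent_le_single_scale hs hB
  have hpq := sub_pos.2 hG.lt
  have h1σ : 0 < 1 - σ := by linarith
  have hσ2 : σ ^ 2 < 1 := by nlinarith
  set e₀ : ℝ := (q - p) * (1 - σ) / 2 with he₀
  have he₀pos : 0 < e₀ := by positivity
  refine ⟨C / e₀ ^ 2 * (1 - σ ^ 2)⁻¹, ?_, ?_⟩
  · have : 0 < 1 - σ ^ 2 := by linarith
    positivity
  intro A hA ε hε k ι M F hF hdiam hN hcov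
  set S : Plane → ℕ → Set ℝ := fun x n =>
    Icc p q ∩ (fun a => x + G a) ⁻¹' ⋃ m ∈ M n, F n m with hS
  set A' : ℕ → Set Plane := fun n =>
    {x ∈ A | ENNReal.ofReal (e₀ * σ ^ n) ≤ volume (S x n)} with hA'
  -- the thresholds sum up to half the length of `[p, q]`, so one of them is exceeded
  have hAA' : A ⊆ ⋃ n, A' n := by
    intro x hx
    by_contra hx'
    simp only [hA', mem_iUnion, mem_sep_iff, not_exists, not_and, not_le] at hx'
    have h1 : Icc p q ⊆ ⋃ n, S x n := by
      intro a ha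
      obtain ⟨n, hn⟩ := mem_iUnion.1 (hcov x hx a ha)
      exact mem_iUnion.2 ⟨n, ha, hn⟩
    have h2 : ENNReal.ofReal (q - p) ≤ ENNReal.ofReal ((q - p) / 2) := by
      calc ENNReal.ofReal (q - p) = volume (Icc p q) := Real.volume_Icc.symm
        _ ≤ ∑' n, volume (S x n) := (measure_mono h1).trans (measure_iUnion_le _)
        _ ≤ ∑' n, ENNReal.ofReal (e₀ * σ ^ n) := ENNReal.tsum_le_tsum fun n => (hx' n hx).le
        _ = ENNReal.ofReal ((q - p) / 2) := by
            rw [← ENNReal.ofReal_tsum_of_nonneg (fun n => by positivity)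
              ((summable_geometric_of_lt_one hσ0.le hσ1).mul_left _), tsum_mul_left,
              tsum_geometric_of_lt_one hσ0.le hσ1]
            congr 1
            rw [he₀]
            field_simp
    rw [ENNReal.ofReal_le_ofReal_iff (by positivity)] at h2
    linarith
  calc hausdorffContent s A ≤ ∑' n, hausdorffContent s (A' n) :=
        (measure_mono hAA').trans (measure_iUnion_le _)
    _ ≤ ∑' n, ENNReal.ofReal (C / e₀ ^ 2 * ε * (σ ^ 2) ^ n) := by
        refine ENNReal.tsum_le_tsum fun n => ?_
        have hpos : 0 < e₀ * σ ^ n := by positivity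
        refine (hC (A' n) (fun x hx y hy => hA x hx.1 y hy.1) (k n) (M n) (F n) (hF n) (hdiam n)
          _ hpos fun x hx => hx.2).trans (ENNReal.ofReal_le_ofReal ?_)
        rw [div_le_iff₀ (by positivity)]
        calc C * ((M n).card * ((1 / 2 : ℝ) ^ k n) ^ τ) ≤ C * (ε * (σ ^ n) ^ 4) :=
              mul_le_mul_of_nonneg_left (hN n) hC0
          _ = _ := by
              field_simp
              ring
    _ = _ := by
        rw [← ENNReal.ofReal_tsum_of_nonneg (fun n => by positivity)
          ((summable_geometric_of_lt_one (by positivity) hσ2).mul_left _), tsum_mul_left,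
          tsum_geometric_of_lt_one (by positivity) hσ2]
        congr 1
        ring

/-- Dimension gain by one: here the covering sets are grouped by scale, and the gap between `u`
and `1 + s` makes the sizes of the groups decrease geometrically. -/
theorem hausdorffContent_eq_zero_of_lt_one (hG : IsCurvedGraph i j G p q L c) {s u : ℝ}
    (hs0 : 0 < s) (hs1 : s < 1) (hu0 : 0 < u) (hu : u < 1 + s) {A Z : Set Plane}
    (hA : ∀ x ∈ A, ∀ y ∈ A, dist x y ≤ 1) (hAZ : ∀ x ∈ A, ∀ a ∈ Icc p q, x + G a ∈ Z)
    (hZ : hausdorffContent u Z = 0) : hausdorffContent s A = 0 := by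
  obtain ⟨B, hB⟩ := sum_dyadic_le_of_lt_one hs1
  set σ : ℝ := (1 / 2) ^ ((1 + s - u) / 4) with hσ
  have hσ0 : 0 < σ := by positivity
  have hσ1 : σ < 1 := Real.rpow_lt_one (by norm_num) (by norm_num) (by linarith)
  obtain ⟨C, -, hC⟩ := hG.hausdorffContent_le_multi_scale hs0 hB hσ0 hσ1
  refine eq_zero_of_forall_le_ofReal_mul (C := C) fun ε hε => ?_
  obtain ⟨t, k, hZt, htk, hsum⟩ := exists_dyadic_cover hu0 hZ (ENNReal.ofReal_pos.2 hε)
  have hcard : ∀ n, ∀ S : Finset ℕ, (∀ m ∈ S, k m = n) →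
      S.card * ((1 / 2 : ℝ) ^ n) ^ u ≤ ε := by
    intro n S hS
    have h1 := (ENNReal.sum_le_tsum S).trans hsum
    rw [Finset.sum_congr rfl fun m hm => by rw [hS m hm], Finset.sum_const, nsmul_eq_mul,
      ← ENNReal.ofReal_natCast, ← ENNReal.ofReal_mul (by positivity),
      ENNReal.ofReal_le_ofReal_iff hε.le] at h1
    exact h1
  have hfin : ∀ n, {m | k m = n}.Finite := by
    intro n
    by_contra hinf
    obtain ⟨N, hN⟩ := exists_nat_gt (ε / ((1 / 2 : ℝ) ^ n) ^ u)
    obtain ⟨S, hS, hScard⟩ := Set.Infinite.exists_subset_card_eq hinf N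
    rw [div_lt_iff₀ (by positivity)] at hN
    have h1 := hcard n S fun m hm => hS hm
    rw [hScard] at h1
    linarith
  refine hC A hA ε hε.le (fun n => n) (fun n => (hfin n).toFinset) (fun _ m => closure (t m))
    (fun _ _ _ => isClosed_closure) ?_ ?_ ?_
  · intro n m hm x hx y hy
    have hm' : k m = n := by simpa using hm
    have h1 := (Metric.edist_le_ediam_of_mem hx hy).trans
      ((Metric.ediam_closure (t m)).le.trans (htk m))
    rw [edist_dist, ENNReal.ofReal_le_ofReal_iff (by positivity), hm'] at h1
    exact h1
  · intro n
    have h1 := hcard n (hfin n).toFinset (by simp)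
    have h2 : ((1 / 2 : ℝ) ^ n) ^ (1 + s) = ((1 / 2 : ℝ) ^ n) ^ u * (σ ^ n) ^ 4 := by
      rw [hσ, ← half_pow_rpow, ← Real.rpow_natCast _ 4, ← Real.rpow_mul (by positivity),
        ← Real.rpow_add (by positivity)]
      congr 1
      push_cast
      ring
    rw [h2, ← mul_assoc]
    gcongr
  · intro x hx a ha
    obtain ⟨m, hm⟩ := mem_iUnion.1 (hZt (hAZ x hx a ha))
    exact mem_iUnion.2 ⟨k m, mem_iUnion₂.2 ⟨m, by simp, subset_closure hm⟩⟩

end IsCurvedGraph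

theorem norm_le_abs_add_abs (x : Plane) : ‖x‖ ≤ |x 0| + |x 1| := by
  rw [EuclideanSpace.norm_eq, Real.sqrt_le_iff]
  refine ⟨by positivity, ?_⟩
  simp only [Fin.sum_univ_two, Real.norm_eq_abs, sq_abs]
  nlinarith [abs_nonneg (x 0), abs_nonneg (x 1), sq_abs (x 0), sq_abs (x 1)]

/-- With `8 * 2 ^ (K - k)` intervals the grid reaches beyond the right end of `[-2 ^ (-k), 2 ^ (-k)]`,
so that the end itself needs no separate treatment. -/
theorem exists_grid_interval {k K : ℕ} (hk : k ≤ K) {u : ℝ} (hu : |u| ≤ (1 / 2) ^ k) :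
    ∃ a : ℕ, a < 8 * 2 ^ (K - k) ∧ u ∈ Icc (-(1 / 2 : ℝ) ^ k + a * (1 / 2) ^ (K + 1))
      (-(1 / 2 : ℝ) ^ k + (a + 1) * (1 / 2) ^ (K + 1)) := by
  have hh : (0 : ℝ) < (1 / 2) ^ (K + 1) := by positivity
  obtain ⟨h1, h2⟩ := abs_le.1 hu
  have h3 : 0 ≤ (u + (1 / 2) ^ k) / (1 / 2) ^ (K + 1) := div_nonneg (by linarith) hh.le
  refine ⟨⌊(u + (1 / 2) ^ k) / (1 / 2) ^ (K + 1)⌋₊, ?_, ?_, ?_⟩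
  · rw [Nat.floor_lt h3, div_lt_iff₀ hh]
    push_cast
    have h4 : (8 * 2 ^ (K - k) : ℝ) * (1 / 2) ^ (K + 1) = 4 * (1 / 2) ^ k := by
      obtain ⟨d, rfl⟩ := Nat.exists_eq_add_of_le hk
      rw [Nat.add_sub_cancel_left, pow_succ, pow_add]
      have : (2 : ℝ) ^ d * (1 / 2) ^ d = 1 := by rw [← mul_pow]; norm_num
      linear_combination 4 * (1 / 2 : ℝ) ^ k * this
    rw [h4]
    have : (0 : ℝ) < (1 / 2) ^ k := by positivity
    linarith
  · have := Nat.floor_le h3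
    rw [le_div_iff₀ hh] at this
    linarith
  · have := Nat.lt_floor_add_one ((u + (1 / 2) ^ k) / (1 / 2) ^ (K + 1))
    rw [div_lt_iff₀ hh] at this
    linarith

/-- The closed cell with indices `(a, b)` of the grid of mesh `2 ^ (-(K + 1))` in the square with
centre `z` and half side length `2 ^ (-k)`. -/
def gridCell (z : Plane) (k K : ℕ) (ab : ℕ × ℕ) : Set Plane :=
  {y | y 0 - z 0 ∈ Icc (-(1 / 2 : ℝ) ^ k + ab.1 * (1 / 2) ^ (K + 1))
      (-(1 / 2 : ℝ) ^ k + (ab.1 + 1) * (1 / 2) ^ (K + 1)) ∧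
    y 1 - z 1 ∈ Icc (-(1 / 2 : ℝ) ^ k + ab.2 * (1 / 2) ^ (K + 1))
      (-(1 / 2 : ℝ) ^ k + (ab.2 + 1) * (1 / 2) ^ (K + 1))}

theorem isClosed_gridCell (z : Plane) (k K : ℕ) (ab : ℕ × ℕ) : IsClosed (gridCell z k K ab) :=
  (isClosed_Icc.preimage (by fun_prop : Continuous fun y : Plane => y 0 - z 0)).inter
    (isClosed_Icc.preimage (by fun_prop : Continuous fun y : Plane => y 1 - z 1))

theorem dist_le_of_mem_gridCell {z : Plane} {k K : ℕ} {ab : ℕ × ℕ} {x y : Plane}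
    (hx : x ∈ gridCell z k K ab) (hy : y ∈ gridCell z k K ab) : dist x y ≤ (1 / 2) ^ K := by
  obtain ⟨⟨h1, h2⟩, h3, h4⟩ := hx
  obtain ⟨⟨h5, h6⟩, h7, h8⟩ := hy
  rw [dist_eq_norm]
  refine (norm_le_abs_add_abs _).trans ?_
  simp only [PiLp.sub_apply]
  have h9 : |x 0 - y 0| ≤ (1 / 2) ^ (K + 1) := abs_le.2 ⟨by linarith, by linarith⟩
  have h10 : |x 1 - y 1| ≤ (1 / 2) ^ (K + 1) := abs_le.2 ⟨by linarith, by linarith⟩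
  have h11 : (1 / 2 : ℝ) ^ (K + 1) = (1 / 2) ^ K * (1 / 2) := pow_succ _ _
  linarith

theorem exists_mem_gridCell {z : Plane} {k K : ℕ} (hk : k ≤ K) {y : Plane}
    (hy : dist y z ≤ (1 / 2) ^ k) :
    ∃ ab ∈ Finset.range (8 * 2 ^ (K - k)) ×ˢ Finset.range (8 * 2 ^ (K - k)),
      y ∈ gridCell z k K ab := by
  rw [dist_eq_norm] at hy
  obtain ⟨a, ha, ha'⟩ := exists_grid_interval hk ((abs_apply_le_norm _ 0).trans hy)
  obtain ⟨b, hb, hb'⟩ := exists_grid_interval hk ((abs_apply_le_norm _ 1).trans hy)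
  exact ⟨(a, b), by simp [ha, hb], ha', hb'⟩

namespace IsCurvedGraph

variable {i j : Fin 2} {G : ℝ → Plane} {p q L c : ℝ}

/-- Positive area: here the covering sets are grouped into blocks `[N n, N (n + 1))` of a
sufficiently sparse sequence, and the sets of a block are cut into grid cells of one size, which in
dimension `2` does not increase the sum. -/
theorem hausdorffContent_eq_zero_of_one_lt (hG : IsCurvedGraph i j G p q L c) {s : ℝ}
    (hs1 : 1 < s) {A Z : Set Plane}
    (hA : ∀ x ∈ A, ∀ y ∈ A, dist x y ≤ 1) (hAZ : ∀ x ∈ A, ∀ a ∈ Icc p q, x + G a ∈ Z)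
    (hZ : hausdorffContent 2 Z = 0) : hausdorffContent s A = 0 := by
  obtain ⟨B, hB⟩ := sum_dyadic_le_of_one_lt hs1
  obtain ⟨C, -, hC⟩ := hG.hausdorffContent_le_multi_scale (by linarith) hB
    (by norm_num : (0 : ℝ) < 1 / 2) (by norm_num)
  refine eq_zero_of_forall_le_ofReal_mul (C := C * 64) fun ε hε => ?_
  obtain ⟨t, k, hZt, htk, hsum⟩ := exists_dyadic_cover two_pos hZ (ENNReal.ofReal_pos.2 hε)
  set f : ℕ → ENNReal := fun m => ENNReal.ofReal (((1 / 2 : ℝ) ^ k m) ^ (2 : ℝ)) with hf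
  have hctr : ∀ m, ∃ z, ∀ y ∈ t m, dist y z ≤ (1 / 2) ^ k m := by
    intro m
    rcases (t m).eq_empty_or_nonempty with h | ⟨z, hz⟩
    · exact ⟨0, by simp [h]⟩
    · refine ⟨z, fun y hy => ?_⟩
      have h1 := (Metric.edist_le_ediam_of_mem hy hz).trans (htk m)
      rwa [edist_dist, ENNReal.ofReal_le_ofReal_iff (by positivity)] at h1
  choose z hz using hctr
  -- `N 0 = 0` and `n ≤ N n` ensure that the blocks exhaust `ℕ`, whether or not `N` is monotone
  have htail : ∀ n : ℕ, ∃ N : ℕ, n ≤ N ∧ (n = 0 → N = 0) ∧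
      ∑' m, f (m + N) ≤ ENNReal.ofReal (ε * ((1 / 2 : ℝ) ^ n) ^ 4) := by
    intro n
    rcases eq_or_ne n 0 with rfl | hn
    · exact ⟨0, le_rfl, fun _ => rfl, by simpa using hsum⟩
    · have h1 := ENNReal.tendsto_sum_nat_add f (ne_top_of_le_ne_top ENNReal.ofReal_ne_top hsum)
      have h2 : (0 : ENNReal) < ENNReal.ofReal (ε * ((1 / 2 : ℝ) ^ n) ^ 4) :=
        ENNReal.ofReal_pos.2 (by positivity)
      obtain ⟨N, hN1, hN2⟩ := ((h1.eventually_le_const h2).and (Filter.eventually_ge_atTop n)).exists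
      exact ⟨N, hN2, fun h => absurd h hn, hN1⟩
  choose N hN1 hN2 hN3 using htail
  set J : ℕ → Finset ℕ := fun n => Finset.Ico (N n) (N (n + 1)) with hJ
  set K : ℕ → ℕ := fun n => (J n).sup k with hK
  have hkK : ∀ n, ∀ m ∈ J n, k m ≤ K n := fun n m hm => Finset.le_sup hm
  have hblock : ∀ m, ∃ n, m ∈ J n := by
    intro m
    have hex : ∃ n, m < N n := ⟨m + 1, hN1 (m + 1)⟩
    obtain ⟨n, hn⟩ := Nat.exists_eq_succ_of_ne_zero (n := Nat.find hex) fun h0 => by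
      have := Nat.find_spec hex
      rw [h0, hN2 0 rfl] at this
      omega
    refine ⟨n, Finset.mem_Ico.2 ⟨?_, ?_⟩⟩
    · exact not_lt.1 (Nat.find_min hex (by omega))
    · have := Nat.find_spec hex
      rwa [hn] at this
  have hmain := hC A hA (64 * ε) (by positivity) K
    (fun n => (J n).sigma fun m =>
      Finset.range (8 * 2 ^ (K n - k m)) ×ˢ Finset.range (8 * 2 ^ (K n - k m)))
    (fun n x => gridCell (z x.1) (k x.1) (K n) x.2) (fun _ _ _ => isClosed_gridCell _ _ _ _)
    (fun _ _ _ x hx y hy => dist_le_of_mem_gridCell hx hy) ?_ ?_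
  · rwa [← mul_assoc] at hmain
  · intro n
    have h1 : ∑ m ∈ J n, ((1 / 2 : ℝ) ^ k m) ^ (2 : ℝ) ≤ ε * ((1 / 2 : ℝ) ^ n) ^ 4 := by
      rw [← ENNReal.ofReal_le_ofReal_iff (by positivity),
        ENNReal.ofReal_sum_of_nonneg fun _ _ => by positivity]
      refine le_trans ?_ (hN3 n)
      rw [hJ, Finset.sum_Ico_eq_sum_range]
      simp_rw [add_comm (N n)]
      exact ENNReal.sum_le_tsum _
    rw [Finset.card_sigma, Nat.cast_sum, Finset.sum_mul, mul_assoc]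
    refine le_trans (le_of_eq ?_) (mul_le_mul_of_nonneg_left h1 (by norm_num))
    rw [Finset.mul_sum]
    refine Finset.sum_congr rfl fun m hm => ?_
    rw [Finset.card_product, Finset.card_range, Real.rpow_two, Real.rpow_two]
    push_cast
    obtain ⟨d, hd⟩ := Nat.exists_eq_add_of_le (hkK n m hm)
    rw [hd, Nat.add_sub_cancel_left, pow_add]
    have : (2 : ℝ) ^ d * (1 / 2) ^ d = 1 := by rw [← mul_pow]; norm_num
    linear_combination 64 * ((1 / 2 : ℝ) ^ k m) ^ 2 * ((2 : ℝ) ^ d * (1 / 2) ^ d + 1) * this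
  · intro x hx a ha
    obtain ⟨m, hm⟩ := mem_iUnion.1 (hZt (hAZ x hx a ha))
    obtain ⟨n, hn⟩ := hblock m
    obtain ⟨ab, hab, hmem⟩ := exists_mem_gridCell (hkK n m hn) (hz m _ hm)
    exact mem_iUnion.2 ⟨n, mem_iUnion₂.2 ⟨⟨m, ab⟩, Finset.mem_sigma.2 ⟨hn, hab⟩, hmem⟩⟩

end IsCurvedGraph

/-! ### Curved graphs in curves with nonzero curvature -/

theorem contDiffAt_deriv {E : Type*} [NormedAddCommGroup E] [NormedSpace ℝ E] {f : ℝ → E} {x : ℝ}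
    {m n : WithTop ℕ∞} (hf : ContDiffAt ℝ n f x) (hmn : m + 1 ≤ n) :
    ContDiffAt ℝ m (deriv f) x :=
  (hf.fderiv_right hmn).clm_apply contDiffAt_const

theorem exists_sub_eq_mul_sub {f f' : ℝ → ℝ} {a b : ℝ}
    (h : ∀ x ∈ uIcc a b, HasDerivAt f (f' x) x) : ∃ ξ ∈ uIcc a b, f a - f b = f' ξ * (a - b) := by
  rcases lt_trichotomy a b with hab | rfl | hab
  · rw [uIcc_of_le hab.le] at *
    obtain ⟨ξ, hξ, hξ'⟩ := exists_hasDerivAt_eq_slope f f' hab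
      (fun x hx => (h x hx).continuousAt.continuousWithinAt)
      fun x hx => h x (Ioo_subset_Icc_self hx)
    refine ⟨ξ, Ioo_subset_Icc_self hξ, ?_⟩
    rw [hξ']
    have : b - a ≠ 0 := by linarith
    field_simp
    ring
  · exact ⟨a, by simp, by simp⟩
  · rw [uIcc_of_ge hab.le] at *
    obtain ⟨ξ, hξ, hξ'⟩ := exists_hasDerivAt_eq_slope f f' hab
      (fun x hx => (h x hx).continuousAt.continuousWithinAt)
      fun x hx => h x (Ioo_subset_Icc_self hx)
    refine ⟨ξ, Ioo_subset_Icc_self hξ, ?_⟩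
    rw [hξ']
    have : a - b ≠ 0 := by linarith
    field_simp

/-- A `C²` function with nonzero second derivative at a point has uniformly nonzero second
differences near that point. -/
theorem exists_second_difference_bound {φ : ℝ → ℝ} {x₀ : ℝ} (hφ : ContDiffAt ℝ 2 φ x₀)
    (h2 : deriv (deriv φ) x₀ ≠ 0) {U : Set ℝ} (hU : U ∈ nhds x₀) :
    ∃ p q L c : ℝ, p < q ∧ 0 < c ∧ 0 ≤ L ∧ Icc p q ⊆ U ∧
      (∀ a ∈ Icc p q, ∀ b ∈ Icc p q, |φ a - φ b| ≤ L * |a - b|) ∧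
      ∀ a b h, a ∈ Icc p q → b ∈ Icc p q → a + h ∈ Icc p q → b + h ∈ Icc p q →
        c * |h| * |a - b| ≤ |(φ (a + h) - φ a) - (φ (b + h) - φ b)| := by
  have hφ1 : ContDiffAt ℝ 1 (deriv φ) x₀ := contDiffAt_deriv hφ (by norm_num)
  have hd1 : ∀ᶠ x in nhds x₀, HasDerivAt φ (deriv φ x) x :=
    (hφ.eventually (by simp)).mono fun x hx => (hx.differentiableAt (by simp)).hasDerivAt
  have hd2 : ∀ᶠ x in nhds x₀, HasDerivAt (deriv φ) (deriv (deriv φ) x) x :=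
    (hφ1.eventually (by simp)).mono fun x hx => (hx.differentiableAt (by simp)).hasDerivAt
  have hc2 : ContinuousAt (deriv (deriv φ)) x₀ :=
    (contDiffAt_deriv (m := 0) hφ1 (by norm_num)).continuousAt
  have hb1 : ∀ᶠ x in nhds x₀, |deriv φ x| < |deriv φ x₀| + 1 :=
    hφ1.continuousAt.abs.eventually_lt continuousAt_const (by linarith)
  have hb2 : ∀ᶠ x in nhds x₀, |deriv (deriv φ) x₀| / 2 < |deriv (deriv φ) x| :=
    continuousAt_const.eventually_lt hc2.abs (by linarith [abs_pos.2 h2])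
  obtain ⟨δ, hδ, hball⟩ := Metric.eventually_nhds_iff.1
    (hd1.and (hd2.and (hb1.and (hb2.and hU))))
  have hI : ∀ x ∈ Icc (x₀ - δ / 2) (x₀ + δ / 2), dist x x₀ < δ := fun x hx => by
    rw [Real.dist_eq, abs_lt]
    constructor <;> linarith [hx.1, hx.2]
  refine ⟨x₀ - δ / 2, x₀ + δ / 2, |deriv φ x₀| + 1, |deriv (deriv φ) x₀| / 2, by linarith,
    half_pos (abs_pos.2 h2), by positivity, fun x hx => (hball (hI x hx)).2.2.2.2, ?_, ?_⟩
  · intro a ha b hb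
    obtain ⟨ξ, hξ, h⟩ := exists_sub_eq_mul_sub (f := φ) (f' := deriv φ) (a := a) (b := b)
      fun x hx => (hball (hI x (uIcc_subset_Icc ha hb hx))).1
    rw [h, abs_mul]
    have := (hball (hI ξ (uIcc_subset_Icc ha hb hξ))).2.2.1
    gcongr
  · intro a b h ha hb hah hbh
    have hshift : ∀ x ∈ uIcc a b, x + h ∈ Icc (x₀ - δ / 2) (x₀ + δ / 2) := by
      intro x hx
      rcases mem_uIcc.1 hx with hx | hx <;>
        constructor <;> linarith [hx.1, hx.2, hah.1, hah.2, hbh.1, hbh.2]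
    obtain ⟨ξ, hξ, h1⟩ := exists_sub_eq_mul_sub (f := fun x => φ (x + h) - φ x)
      (f' := fun x => deriv φ (x + h) - deriv φ x) (a := a) (b := b) fun x hx =>
        ((hball (hI _ (hshift x hx))).1.comp_add_const x h).sub
          (hball (hI x (uIcc_subset_Icc ha hb hx))).1
    have hξ' := uIcc_subset_Icc ha hb hξ
    obtain ⟨η, hη, h2⟩ := exists_sub_eq_mul_sub (f := deriv φ) (f' := deriv (deriv φ))
      (a := ξ + h) (b := ξ) fun x hx =>
        (hball (hI x (uIcc_subset_Icc (hshift ξ hξ) hξ' hx))).2.1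
    have h3 := (hball (hI η (uIcc_subset_Icc (hshift ξ hξ) hξ' hη))).2.2.2.1
    rw [h1, h2, abs_mul, abs_mul, add_sub_cancel_left]
    gcongr

theorem norm_le_abs_add_abs_of_ne {i j : Fin 2} (hij : i ≠ j) (x : Plane) :
    ‖x‖ ≤ |x i| + |x j| := by
  have h := norm_le_abs_add_abs x
  fin_cases i <;> fin_cases j <;> simp at hij ⊢ <;> linarith

theorem HasDerivAt.plane_apply {γ : ℝ → Plane} {γ' : Plane} {t : ℝ} (h : HasDerivAt γ γ' t)
    (i : Fin 2) : HasDerivAt (fun t => γ t i) (γ' i) t :=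
  (EuclideanSpace.proj (𝕜 := ℝ) i).hasFDerivAt.comp_hasDerivAt t h

/-- Near a parameter at which the `i`-th velocity and the curvature do not vanish, the inverse
function theorem reparametrizes the curve as a curved graph over the `i`-th coordinate. -/
theorem exists_isCurvedGraph_of_apply_ne_zero {γ : ℝ → Plane} {t₀ : ℝ} {i j : Fin 2} (hij : i ≠ j)
    (hγ : ContDiffAt ℝ 2 γ t₀) (hi : deriv γ t₀ i ≠ 0)
    (hdet : deriv γ t₀ i * deriv (deriv γ) t₀ j - deriv γ t₀ j * deriv (deriv γ) t₀ i ≠ 0)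
    {U : Set ℝ} (hU : U ∈ nhds t₀) :
    ∃ (G : ℝ → Plane) (p q L c : ℝ), IsCurvedGraph i j G p q L c ∧
      ∀ a ∈ Icc p q, G a ∈ γ '' U := by
  have hγ1 : ContDiffAt ℝ 1 (deriv γ) t₀ := contDiffAt_deriv hγ (by norm_num)
  have hd1 : ∀ᶠ t in nhds t₀, HasDerivAt γ (deriv γ t) t :=
    (hγ.eventually (by simp)).mono fun x hx => (hx.differentiableAt (by simp)).hasDerivAt
  have hd2 : HasDerivAt (deriv γ) (deriv (deriv γ) t₀) t₀ :=
    (hγ1.differentiableAt (by simp)).hasDerivAt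
  set u : ℝ → ℝ := fun t => γ t i with hu
  set v : ℝ → ℝ := fun t => γ t j with hv
  have hucd : ContDiffAt ℝ 2 u t₀ := (EuclideanSpace.proj (𝕜 := ℝ) i).contDiff.contDiffAt.comp t₀ hγ
  have hvcd : ContDiffAt ℝ 2 v t₀ := (EuclideanSpace.proj (𝕜 := ℝ) j).contDiff.contDiffAt.comp t₀ hγ
  have hu' : HasDerivAt u (deriv γ t₀ i) t₀ := hd1.self_of_nhds.plane_apply i
  set e := ContinuousLinearEquiv.unitsEquivAut ℝ (Units.mk0 _ hi) with he
  have hfd : HasFDerivAt u (e : ℝ →L[ℝ] ℝ) t₀ := hu'.hasFDerivAt_equiv hi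
  set ψ := hucd.localInverse hfd (by simp) with hψ
  have hψcd : ContDiffAt ℝ 2 ψ (u t₀) := hucd.to_localInverse hfd (by simp)
  have hstr := hucd.hasStrictFDerivAt' hfd (by simp)
  have hright : ∀ᶠ x in nhds (u t₀), u (ψ x) = x := hstr.eventually_right_inverse
  have hleft : ∀ᶠ t in nhds t₀, ψ (u t) = t := hstr.eventually_left_inverse
  have hψ0 : ψ (u t₀) = t₀ := hleft.self_of_nhds
  set φ : ℝ → ℝ := v ∘ ψ with hφ
  have hφcd : ContDiffAt ℝ 2 φ (u t₀) := by
    refine ContDiffAt.comp _ ?_ hψcd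
    rwa [hψ0]
  have hφ1 : ContDiffAt ℝ 1 (deriv φ) (u t₀) := contDiffAt_deriv hφcd (by norm_num)
  have hφ2 : deriv (deriv φ) (u t₀) ≠ 0 := by
    -- differentiate `v = φ ∘ u` twice
    intro h0
    have hφd : ∀ᶠ x in nhds (u t₀), HasDerivAt φ (deriv φ x) x :=
      (hφcd.eventually (by simp)).mono fun x hx => (hx.differentiableAt (by simp)).hasDerivAt
    have hφu : ∀ᶠ t in nhds t₀, φ (u t) = v t := hleft.mono fun t ht => by simp [hφ, ht]
    have hv1 : ∀ᶠ t in nhds t₀, deriv γ t j = deriv φ (u t) * deriv γ t i := by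
      filter_upwards [hd1, hφu.eventually_nhds, hu'.continuousAt.eventually hφd] with t h1 h2 h3
      have h4 := (h3.comp t (h1.plane_apply i)).congr_of_eventuallyEq
        (h2.mono fun s hs => hs.symm)
      exact (h1.plane_apply j).unique h4
    have hv2 : deriv (deriv γ) t₀ j = deriv φ (u t₀) * deriv (deriv γ) t₀ i := by
      have h1 : HasDerivAt (deriv φ) 0 (u t₀) := by
        rw [← h0]
        exact (hφ1.differentiableAt (by simp)).hasDerivAt
      have h2 := (h1.comp t₀ hu').mul (hd2.plane_apply i)
      have h3 := (hd2.plane_apply j).unique (h2.congr_of_eventuallyEq hv1)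
      simpa using h3
    apply hdet
    rw [hv2, hv1.self_of_nhds]
    ring
  have hU' : ∀ᶠ x in nhds (u t₀), ψ x ∈ U :=
    hψcd.continuousAt.eventually (by rw [hψ0]; exact hU)
  have hcont : ∀ᶠ x in nhds (u t₀), ContinuousAt (γ ∘ ψ) x := by
    have : ContDiffAt ℝ 2 (γ ∘ ψ) (u t₀) := by
      refine ContDiffAt.comp _ ?_ hψcd
      rwa [hψ0]
    exact (this.eventually (by simp)).mono fun x hx => hx.continuousAt
  obtain ⟨p, q, L, c, hpq, hc, hL, hsub, hlip, hcurv⟩ := exists_second_difference_bound hφcd hφ2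
    (hU'.and (hcont.and hright))
  set G : ℝ → Plane := fun x => γ (ψ (projIcc p q hpq.le x)) with hG
  have hGeq : ∀ a ∈ Icc p q, G a = γ (ψ a) := fun a ha => by
    simp only [hG, projIcc_of_mem hpq.le ha]
  have hGi : ∀ a ∈ Icc p q, G a i = a := fun a ha => by
    rw [hGeq a ha]
    exact (hsub ha).2.2
  have hGj : ∀ a ∈ Icc p q, G a j = φ a := fun a ha => by
    rw [hGeq a ha]
    rfl
  refine ⟨G, p, q, 1 + L, c, ⟨hpq, hij, hc, by linarith, ?_, hGi, ?_, ?_⟩, ?_⟩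
  · have h1 : ContinuousOn (γ ∘ ψ) (Icc p q) := fun x hx =>
      (hsub hx).2.1.continuousWithinAt
    exact (continuousOn_iff_continuous_domRestrict.1 h1).comp continuous_projIcc
  · intro a ha b hb
    refine (norm_le_abs_add_abs_of_ne hij _).trans ?_
    simp only [PiLp.sub_apply]
    rw [hGi a ha, hGi b hb, hGj a ha, hGj b hb]
    linarith [hlip a ha b hb]
  · intro a b h ha hb hah hbh
    rw [hGj a ha, hGj b hb, hGj _ hah, hGj _ hbh]
    exact hcurv a b h ha hb hah hbh
  · intro a ha
    rw [hGeq a ha]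
    exact ⟨_, (hsub ha).1, rfl⟩

namespace PiecewiseC2Curve

/-- A curve that is not piecewise linear contains a curved graph. -/
theorem exists_isCurvedGraph (Γ : PiecewiseC2Curve) (hΓ : ¬ Γ.IsPiecewiseLinear) :
    ∃ (i j : Fin 2) (G : ℝ → Plane) (p q L c : ℝ), IsCurvedGraph i j G p q L c ∧
      ∀ a ∈ Icc p q, G a ∈ Γ.carrier := by
  simp only [IsPiecewiseLinear, not_forall] at hΓ
  obtain ⟨m, t₀, ht₀, hκ⟩ := hΓ
  have hU : Ioo (Γ.a m.castSucc) (Γ.a m.succ) ∈ nhds t₀ := isOpen_Ioo.mem_nhds ht₀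
  have hγ : ContDiffAt ℝ 2 Γ.toFun t₀ := (Γ.contDiffOn m).contDiffAt hU
  have hsub : Γ.toFun '' Ioo (Γ.a m.castSucc) (Γ.a m.succ) ⊆ Γ.carrier := by
    refine image_mono (Ioo_subset_Icc_self.trans (Icc_subset_Icc ?_ ?_))
    · rw [← Γ.a_zero]
      exact Γ.strictMono_a.monotone (Fin.zero_le _)
    · rw [← Γ.a_last]
      exact Γ.strictMono_a.monotone (Fin.le_last _)
  rw [planeCurvature, div_eq_zero_iff, not_or, abs_eq_zero] at hκ
  obtain ⟨hdet, hnorm⟩ := hκ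
  by_cases h0 : deriv Γ.toFun t₀ 0 = 0
  · have h1 : deriv Γ.toFun t₀ 1 ≠ 0 := by
      intro h1
      simp [h0, h1] at hdet
    obtain ⟨G, p, q, L, c, hG, hGU⟩ := exists_isCurvedGraph_of_apply_ne_zero
      (i := 1) (j := 0) (by simp) hγ h1 (fun h => hdet (by linarith)) hU
    exact ⟨1, 0, G, p, q, L, c, hG, fun a ha => hsub (hGU a ha)⟩
  · obtain ⟨G, p, q, L, c, hG, hGU⟩ := exists_isCurvedGraph_of_apply_ne_zero
      (i := 0) (j := 1) (by simp) hγ h0 hdet hU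
    exact ⟨0, 1, G, p, q, L, c, hG, fun a ha => hsub (hGU a ha)⟩

end PiecewiseC2Curve

/-! ### The upper bound for the dimension and the conclusion -/

/-- A covering set of `A` of diameter `2 ^ (-k)` gives about `2 ^ k` covering sets of comparable
diameter of the sum of `A` and a Lipschitz arc, which costs one dimension. -/
theorem hausdorffContent_add_image_Icc_eq_zero {γ : ℝ → Plane} {p q K s : ℝ} (hs : 0 < s)
    (hK : 0 ≤ K) (hγ : ∀ a ∈ Icc p q, ∀ b ∈ Icc p q, dist (γ a) (γ b) ≤ K * |a - b|)
    {A : Set Plane} (hA : hausdorffContent s A = 0) :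
    hausdorffContent (s + 1) (A + γ '' Icc p q) = 0 := by
  refine eq_zero_of_forall_le_ofReal_mul (C := (1 + K) ^ (s + 1) * (|q - p| + 2))
    fun ε hε => ?_
  obtain ⟨t, k, hAt, htk, hsum⟩ := exists_dyadic_cover hs hA (ENNReal.ofReal_pos.2 hε)
  set N : ℕ → ℕ := fun m => ⌈|q - p| * 2 ^ k m⌉₊ + 1 with hN
  -- the part of the arc over a parameter interval as short as the covering set
  set S : ℕ → ℕ → Set Plane := fun m l => t m + γ '' (Icc p q ∩
    Icc (p + l * (1 / 2) ^ k m) (p + (l + 1) * (1 / 2) ^ k m)) with hS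
  have hone : ∀ m : ℕ, (2 : ℝ) ^ m * (1 / 2) ^ m = 1 := fun m => by rw [← mul_pow]; norm_num
  have hcov : A + γ '' Icc p q ⊆ ⋃ m, ⋃ l ∈ Finset.range (N m), S m l := by
    rintro _ ⟨x, hx, _, ⟨a, ha, rfl⟩, rfl⟩
    obtain ⟨m, hm⟩ := mem_iUnion.1 (hAt hx)
    have h0 : 0 ≤ (a - p) * 2 ^ k m := mul_nonneg (by linarith [ha.1]) (by positivity)
    have hh : (0 : ℝ) < (1 / 2) ^ k m := by positivity
    have ha' : (a - p) * 2 ^ k m * (1 / 2) ^ k m = a - p := by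
      rw [mul_assoc, hone, mul_one]
    refine mem_iUnion.2 ⟨m, mem_iUnion₂.2 ⟨⌊(a - p) * 2 ^ k m⌋₊, ?_, ?_⟩⟩
    · rw [Finset.mem_range, hN, Nat.lt_succ_iff]
      refine (Nat.floor_le_ceil _).trans (Nat.ceil_mono ?_)
      gcongr
      exact (sub_le_sub_right ha.2 p).trans (le_abs_self _)
    · refine add_mem_add hm ⟨a, ⟨ha, ?_, ?_⟩, rfl⟩
      · have := mul_le_mul_of_nonneg_right (Nat.floor_le h0) hh.le
        linarith
      · have := mul_le_mul_of_nonneg_right (Nat.lt_floor_add_one ((a - p) * 2 ^ k m)).le hh.le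
        linarith
  have hdiam : ∀ m l, Metric.ediam (S m l) ≤ ENNReal.ofReal ((1 + K) * (1 / 2) ^ k m) := by
    intro m l
    refine Metric.ediam_le_of_forall_dist_le ?_
    rintro _ ⟨x, hx, _, ⟨a, ⟨ha, ha'⟩, rfl⟩, rfl⟩ _ ⟨y, hy, _, ⟨b, ⟨hb, hb'⟩, rfl⟩, rfl⟩
    have h1 := (Metric.edist_le_ediam_of_mem hx hy).trans (htk m)
    rw [edist_dist, ENNReal.ofReal_le_ofReal_iff (by positivity)] at h1
    have h2 : |a - b| ≤ (1 / 2) ^ k m := by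
      rw [abs_le]
      constructor <;> linarith [ha'.1, ha'.2, hb'.1, hb'.2]
    calc dist (x + γ a) (y + γ b) ≤ dist x y + dist (γ a) (γ b) := dist_add_add_le _ _ _ _
      _ ≤ (1 / 2) ^ k m + K * (1 / 2) ^ k m := by
          gcongr
          exact (hγ a ha b hb).trans (by gcongr)
      _ = _ := by ring
  calc hausdorffContent (s + 1) (A + γ '' Icc p q)
      ≤ ∑' m, ∑ l ∈ Finset.range (N m), hausdorffContent (s + 1) (S m l) :=
        (measure_mono hcov).trans ((measure_iUnion_le _).trans
          (ENNReal.tsum_le_tsum fun m => measure_biUnion_finset_le _ _))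
    _ ≤ ∑' m, ENNReal.ofReal ((1 + K) ^ (s + 1) * (|q - p| + 2)) *
          ENNReal.ofReal (((1 / 2 : ℝ) ^ k m) ^ s) := by
        refine ENNReal.tsum_le_tsum fun m => ?_
        have h1 : ∀ l ∈ Finset.range (N m), hausdorffContent (s + 1) (S m l) ≤
            ENNReal.ofReal (((1 + K) * (1 / 2) ^ k m) ^ (s + 1)) := fun l _ => by
          refine (hausdorffContent_le_ediam _ _).trans ?_
          rw [← ENNReal.ofReal_rpow_of_pos (by positivity)]
          exact ENNReal.rpow_le_rpow (hdiam m l) (by positivity)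
        refine (Finset.sum_le_card_nsmul _ _ _ h1).trans ?_
        rw [Finset.card_range, nsmul_eq_mul, ← ENNReal.ofReal_natCast,
          ← ENNReal.ofReal_mul (by positivity), ← ENNReal.ofReal_mul (by positivity)]
        refine ENNReal.ofReal_le_ofReal ?_
        rw [Real.mul_rpow (by positivity) (by positivity),
          Real.rpow_add (by positivity : (0 : ℝ) < (1 / 2) ^ k m), Real.rpow_one]
        have h2 : (N m : ℝ) * (1 / 2) ^ k m ≤ |q - p| + 2 := by
          have h3 : (N m : ℝ) ≤ |q - p| * 2 ^ k m + 2 := by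
            have := Nat.ceil_lt_add_one (by positivity : 0 ≤ |q - p| * 2 ^ k m)
            rw [hN]
            push_cast
            linarith
          have h4 : (1 / 2 : ℝ) ^ k m ≤ 1 := pow_le_one₀ (by norm_num) (by norm_num)
          calc (N m : ℝ) * (1 / 2) ^ k m ≤ (|q - p| * 2 ^ k m + 2) * (1 / 2) ^ k m := by gcongr
            _ = |q - p| * (2 ^ k m * (1 / 2) ^ k m) + 2 * (1 / 2) ^ k m := by ring
            _ ≤ _ := by rw [hone]; linarith
        calc (N m : ℝ) * ((1 + K) ^ (s + 1) * (((1 / 2) ^ k m) ^ s * (1 / 2) ^ k m))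
            = (1 + K) ^ (s + 1) * (N m * (1 / 2) ^ k m) * ((1 / 2) ^ k m) ^ s := by ring
          _ ≤ _ := by gcongr
    _ ≤ _ := by
        rw [ENNReal.tsum_mul_left, ENNReal.ofReal_mul (q := ε) (by positivity)]
        exact mul_le_mul_right hsum _

theorem dimH_add_image_Icc_le {γ : ℝ → Plane} {p q K : ℝ}
    (hK : 0 ≤ K) (hγ : ∀ a ∈ Icc p q, ∀ b ∈ Icc p q, dist (γ a) (γ b) ≤ K * |a - b|)
    (A : Set Plane) : dimH (A + γ '' Icc p q) ≤ 1 + dimH A := by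
  borelize Plane
  by_contra! h
  obtain ⟨d, hd1, hd2⟩ := ENNReal.lt_iff_exists_nnreal_btwn.1 h
  have hd : 1 < d := by
    have := lt_of_le_of_lt le_self_add hd1
    exact_mod_cast this
  have hAd : dimH A < ((d - 1 : NNReal) : ENNReal) := by
    rw [ENNReal.coe_sub, ENNReal.coe_one]
    exact lt_tsub_iff_left.2 hd1
  have h1 := hausdorffMeasure_of_dimH_lt hAd
  have h2 : (0 : ℝ) < ((d - 1 : NNReal) : ℝ) := NNReal.coe_pos.2 (tsub_pos_of_lt hd)
  have h3 : hausdorffContent ((d - 1 : NNReal) : ℝ) A = 0 :=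
    le_antisymm (h1 ▸ hausdorffContent_le_hausdorffMeasure _ A) zero_le
  have h4 := hausdorffMeasure_eq_zero_of_hausdorffContent (by positivity)
    (hausdorffContent_add_image_Icc_eq_zero h2 hK hγ h3)
  rw [NNReal.coe_sub hd.le, NNReal.coe_one, sub_add_cancel] at h4
  rw [hausdorffMeasure_of_lt_dimH hd2] at h4
  exact ENNReal.top_ne_zero h4

namespace PiecewiseC2Curve

theorem exists_eq_or_mem_Ioo (Γ : PiecewiseC2Curve) {t : ℝ} (ht : t ∈ Icc 0 Γ.T) :
    (∃ m, t = Γ.a m) ∨ ∃ m : Fin Γ.n, t ∈ Ioo (Γ.a m.castSucc) (Γ.a m.succ) := by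
  classical
  obtain ⟨m, hm, hmax⟩ := Finset.exists_max_image (Finset.univ.filter fun m => Γ.a m ≤ t) id
    ⟨0, by simpa [Γ.a_zero] using ht.1⟩
  simp only [Finset.mem_filter, Finset.mem_univ, true_and, id] at hm hmax
  rcases hm.eq_or_lt with h | h
  · exact Or.inl ⟨m, h.symm⟩
  · right
    have hlast : m ≠ Fin.last _ := by
      rintro rfl
      rw [Γ.a_last] at h
      linarith [ht.2]
    obtain ⟨m, rfl⟩ := Fin.exists_castSucc_eq.2 hlast
    refine ⟨m, h, not_le.1 fun h' => ?_⟩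
    exact absurd (hmax _ h') (not_le.2 Fin.castSucc_lt_succ)

/-- The curve is a countable union of points and Lipschitz arcs, and adding one of those raises
the dimension by at most one. Near the partition points, the curve itself need not be Lipschitz. -/
theorem dimH_add_carrier_le (Γ : PiecewiseC2Curve) (A : Set Plane) :
    dimH (A + Γ.carrier) ≤ 1 + dimH A := by
  have hsub : A + Γ.carrier ⊆ (⋃ m, A + {Γ.toFun (Γ.a m)}) ∪ ⋃ (m : Fin Γ.n), ⋃ (n : ℕ),
      A + Γ.toFun '' Icc (Γ.a m.castSucc + 1 / (n + 1)) (Γ.a m.succ - 1 / (n + 1)) := by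
    rintro _ ⟨x, hx, _, ⟨t, ht, rfl⟩, rfl⟩
    rcases Γ.exists_eq_or_mem_Ioo ht with ⟨m, rfl⟩ | ⟨m, hm⟩
    · exact Or.inl (mem_iUnion.2 ⟨m, add_mem_add hx rfl⟩)
    · obtain ⟨n, hn⟩ := exists_nat_one_div_lt
        (lt_min (sub_pos.2 hm.1) (sub_pos.2 hm.2))
      rw [lt_min_iff] at hn
      exact Or.inr (mem_iUnion₂.2 ⟨m, n, add_mem_add hx
        ⟨t, ⟨by linarith [hn.1], by linarith [hn.2]⟩, rfl⟩⟩)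
  refine (dimH_mono hsub).trans ?_
  rw [dimH_union, dimH_iUnion, dimH_iUnion]
  refine max_le (iSup_le fun m => ?_) (iSup_le fun m => ?_)
  · rw [add_singleton]
    exact ((LipschitzWith.id.add (LipschitzWith.const _)).dimH_image_le A).trans le_add_self
  · rw [dimH_iUnion]
    refine iSup_le fun n => ?_
    have hpos : (0 : ℝ) < 1 / (n + 1) := by positivity
    obtain ⟨K, hK⟩ := (((Γ.contDiffOn m).of_le (by norm_num)).mono
      (Icc_subset_Ioo (by linarith) (by linarith) : Icc (Γ.a m.castSucc + 1 / ((n : ℝ) + 1))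
        (Γ.a m.succ - 1 / (n + 1)) ⊆ _)).exists_lipschitzOnWith (n := 1) (by norm_num)
        (convex_Icc _ _) isCompact_Icc
    exact dimH_add_image_Icc_le K.coe_nonneg (fun a ha b hb => hK.dist_le_mul a ha b hb) A

end PiecewiseC2Curve

theorem hausdorffMeasure_two_eq_zero {Z : Set Plane} (h : volume Z = 0) : μH[2] Z = 0 := by
  have h1 : ((Module.finrank ℝ Plane : ℕ) : ℝ) = 2 := by simp
  rw [← h1]
  exact Measure.absolutelyContinuous_isAddHaarMeasure _ _ h

/-- A set is null for the Hausdorff content if its parts of diameter at most `1` are. -/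
theorem hausdorffContent_eq_zero_of_small {s : ℝ} {A : Set Plane}
    (h : ∀ A' ⊆ A, (∀ x ∈ A', ∀ y ∈ A', dist x y ≤ 1) → hausdorffContent s A' = 0) :
    hausdorffContent s A = 0 := by
  have hsub : A ⊆ ⋃ n, A ∩ Metric.ball (TopologicalSpace.denseSeq Plane n) (1 / 2) := by
    intro x hx
    obtain ⟨n, hn⟩ := (TopologicalSpace.denseRange_denseSeq Plane).exists_dist_lt x
      (by norm_num : (0 : ℝ) < 1 / 2)
    exact mem_iUnion.2 ⟨n, hx, hn⟩
  refine measure_mono_null hsub (measure_iUnion_null fun n => h _ inter_subset_left ?_)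
  intro x hx y hy
  have h1 := hx.2
  have h2 := hy.2
  rw [Metric.mem_ball] at h1 h2
  linarith [dist_triangle_right x y (TopologicalSpace.denseSeq Plane n)]

/-- Projected to the `i`-th coordinate, any translate of a curved graph contains an interval. -/
theorem IsCurvedGraph.one_le_dimH {i j : Fin 2} {G : ℝ → Plane} {p q L c : ℝ}
    (hG : IsCurvedGraph i j G p q L c) {A Z : Set Plane} (hA : A.Nonempty)
    (hAZ : ∀ x ∈ A, ∀ a ∈ Icc p q, x + G a ∈ Z) : 1 ≤ dimH Z := by
  obtain ⟨x, hx⟩ := hA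
  have hlip := (EuclideanSpace.proj i : Plane →L[ℝ] ℝ).lipschitz
  refine le_trans ?_ (hlip.dimH_image_le Z)
  have hsub : Icc (x i + p) (x i + q) ⊆ (EuclideanSpace.proj i : Plane →L[ℝ] ℝ) '' Z := by
    intro y hy
    have ha : y - x i ∈ Icc p q := ⟨by linarith [hy.1], by linarith [hy.2]⟩
    exact ⟨_, hAZ x hx _ ha, by simp [hG.apply_eq _ ha]⟩
  refine le_trans (le_of_eq ?_) (dimH_mono hsub)
  have hpq := hG.lt
  rw [Real.dimH_of_mem_nhds (Icc_mem_nhds (by linarith : x i + p < x i + (p + q) / 2)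
    (by linarith))]
  simp

theorem theorem2p1 (Γ : PiecewiseC2Curve) (hΓ : ¬ Γ.IsPiecewiseLinear) (A : Set Plane) :
    (1 < dimH A → 0 < volume (A + Γ.carrier)) ∧
    (A.Nonempty → dimH A ≤ 1 → dimH (A + Γ.carrier) = 1 + dimH A) := by
  obtain ⟨i, j, G, p, q, L, c, hG, hGΓ⟩ := Γ.exists_isCurvedGraph hΓ
  have hAZ : ∀ x ∈ A, ∀ a ∈ Icc p q, x + G a ∈ A + Γ.carrier := fun x hx a ha =>
    add_mem_add hx (hGΓ a ha)
  have hne : ∀ s : NNReal, 0 < s → s < dimH A → hausdorffContent (s : ℝ) A ≠ 0 := by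
    intro s hs hsA h0
    have h1 := hausdorffMeasure_eq_zero_of_hausdorffContent (NNReal.coe_pos.2 hs) h0
    rw [hausdorffMeasure_of_lt_dimH hsA] at h1
    exact ENNReal.top_ne_zero h1
  refine ⟨fun hdim => ?_, fun hA hdim => le_antisymm (Γ.dimH_add_carrier_le A) ?_⟩
  · obtain ⟨s, hs1, hs2⟩ := ENNReal.lt_iff_exists_nnreal_btwn.1 hdim
    have hs1' : 1 < s := by exact_mod_cast hs1
    refine pos_iff_ne_zero.2 fun hvol => hne s (by positivity) hs2 ?_
    have hZ : hausdorffContent 2 (A + Γ.carrier) = 0 :=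
      le_antisymm ((hausdorffContent_le_hausdorffMeasure _ _).trans_eq
        (hausdorffMeasure_two_eq_zero hvol)) zero_le
    exact hausdorffContent_eq_zero_of_small fun A' hA' hdiam =>
      hG.hausdorffContent_eq_zero_of_one_lt (by exact_mod_cast hs1') hdiam
        (fun x hx => hAZ x (hA' hx)) hZ
  · rcases eq_or_ne (dimH A) 0 with h0 | h0
    · rw [h0, add_zero]
      exact hG.one_le_dimH hA hAZ
    · by_contra! hlt
      obtain ⟨u, hu1, hu2⟩ := ENNReal.lt_iff_exists_nnreal_btwn.1 hlt
      have hu3 : (u : ENNReal) - 1 < dimH A := by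
        rcases le_total (u : ENNReal) 1 with h1 | h1
        · rw [tsub_eq_zero_of_le h1]
          exact pos_iff_ne_zero.2 h0
        · exact (ENNReal.sub_lt_iff_lt_left ENNReal.one_ne_top h1).2 hu2
      -- an `s` in `(0, 1)` below the dimension of `A` that still satisfies `u < 1 + s`
      obtain ⟨s, hs1, hs2⟩ := ENNReal.lt_iff_exists_nnreal_btwn.1 hu3
      have hs0 : 0 < s := ENNReal.coe_pos.1 (lt_of_le_of_lt zero_le hs1)
      have hs1' : s < 1 := by exact_mod_cast hs2.trans_le hdim
      have hus : u < 1 + s := not_le.1 fun h =>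
        not_le.2 hs1 (ENNReal.le_sub_of_add_le_left ENNReal.one_ne_top (by exact_mod_cast h))
      have hu0 : 0 < u := ENNReal.coe_pos.1 (lt_of_le_of_lt zero_le hu1)
      refine hne s hs0 hs2 ?_
      have hZ : hausdorffContent (u : ℝ) (A + Γ.carrier) = 0 :=
        le_antisymm ((hausdorffContent_le_hausdorffMeasure _ _).trans_eq
          (hausdorffMeasure_of_dimH_lt hu1)) zero_le
      exact hausdorffContent_eq_zero_of_small fun A' hA' hdiam =>
        hG.hausdorffContent_eq_zero_of_lt_one (NNReal.coe_pos.2 hs0) (by exact_mod_cast hs1')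
          (NNReal.coe_pos.2 hu0) (by exact_mod_cast hus) hdiam (fun x hx => hAZ x (hA' hx)) hZ
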